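/- **Conventions.** Let $(V,\mathrm{dist})$ be a finite metric space and let $z,k\ge 1$ be integers. For $p\in V$ and a nonempty $S\subseteq V$ put $\mathrm{cost}(p,S)=\min_{s\in S}\mathrm{dist}(p,s)^z$. Let $P\subseteq V$ be a set of clients, $\Omega\subseteq V$ a set of points with weights $w:\Omega\to[0,\infty)$, and $\Delta\in\mathbb R$. Then $(\Omega,w)$ is an *$(\varepsilon,k,z)$-coreset for $P$ using offset $\Delta$* if for every $S\subseteq V$ with $|S|=k$, $$\Big|\sum_{p\in P}\mathrm{cost}(p,S)-\Big(\Delta+\sum_{p\in\Omega}w(p)\,\mathrm{cost}(p,S)\Big)\Big|\le\varepsilon\sum_{p\in P}\mathrm{cost}(p,S).$$ The *doubling dimension* of $V$ is the least real $d$ such that every closed ball of radius $r>0$ can be covered by at most $2^d$ closed balls of radius $r/2$ (centred in $V$); thus $2^d$ is always an integer. A *graph metric* is the shortest-path metric of a connected graph with positive edge lengths. $\log$ is the natural logarithm. **Statement.** For every real $A$ and every $\varepsilon_0<1/2$ there is a constant $c>0$, depending only on $A$ and $\varepsilon_0$, such that the following holds. Let $z\ge1$ and $k\ge1$ be integers,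 let $0<\varepsilon<1/2$, and let $D$ be a real number with $D\ge 5\log(1/\varepsilon)$ and $\log k\le A\,D$. Then there are a finite graph metric $V$ of doubling dimension at most $D$, and exactly $D$ whenever $2^D$ is an integer, and a set of clients $P\subseteq V$, such that every $(\varepsilon,k,z)$-coreset $(\Omega,w)$ for $P$ using any offset $\Delta\in\mathbb R$ satisfies $$|\Omega|\ \ge\ c\,\frac{kD}{\varepsilon^2},$$ provided that $\Omega\subseteq P$ or $\varepsilon\le\varepsilon_0$. (So the constant is uniform over all $0<\varepsilon<1/2$ for coresets consisting of clients, and uniform over $0<\varepsilon\le\varepsilon_0$ for coresets that may use arbitrary points of $V$.) -/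

import Mathlib

/-- `V` carries the shortest-path metric of a graph with positive edge lengths: for some graph `G`
on the vertex set `V` and lengths `ℓ > 0` of its edges, `dist u v` is the least length of a walk
from `u` to `v` (in particular `G` is connected). -/
def IsGraphMetric (V : Type*) [MetricSpace V] : Prop :=
  ∃ (G : SimpleGraph V) (ℓ : Sym2 V → ℝ), (∀ e ∈ G.edgeSet, 0 < ℓ e) ∧
    ∀ u v : V, IsLeast (Set.range fun p : G.Walk u v => (p.edges.map ℓ).sum) (dist u v)

/-- The doubling dimension of `X` is at most `d`: every ball can be covered by at most `2 ^ d`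
balls of half its radius. -/
def DoublingDimLE (X : Type*) [MetricSpace X] (d : ℝ) : Prop :=
  ∀ (x : X) (r : ℝ), 0 < r → ∃ t : Finset X, (t.card : ℝ) ≤ (2 : ℝ) ^ d ∧
    Metric.closedBall x r ⊆ ⋃ y ∈ t, Metric.closedBall y (r / 2)

/-- `d` is the doubling dimension of `X`: the least `d` such that every ball can be covered by at
most `2 ^ d` balls of half its radius. -/
def IsDoublingDim (X : Type*) [MetricSpace X] (d : ℝ) : Prop :=
  IsLeast {d' : ℝ | DoublingDimLE X d'} d

/-- The cost `min_{s ∈ S} dist(p, s) ^ z` of the point `p` in the (nonempty) solution `S`. -/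
noncomputable def clusterCost {X : Type*} [MetricSpace X] (z : ℕ) (p : X) (S : Finset X) : ℝ :=
  ⨅ s : S, dist p (s : X) ^ z

/-- The points `Ω` with the nonnegative weights `w` form an `(ε, k, z)`-coreset using offset `Δ`
for the set of clients `P`. -/
def IsCoreset {X : Type*} [MetricSpace X] (ε : ℝ) (k z : ℕ) (P Ω : Finset X) (w : X → ℝ)
    (Δ : ℝ) : Prop :=
  (∀ p ∈ Ω, 0 ≤ w p) ∧
    ∀ S : Finset X, S.card = k →
      |∑ p ∈ P, clusterCost z p S - (Δ + ∑ p ∈ Ω, w p * clusterCost z p S)|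
        ≤ ε * ∑ p ∈ P, clusterCost z p S

/-!
The space consists of `k` copies of a *gadget* and of spare copies, placed at distances that grow
geometrically (`Tower`). A ball of large radius is covered by two smaller ones, except at the top
scale, where the spare copies form an equilateral set; so if a gadget has at most `⌊2 ^ D⌋` points,
the number of spare copies can be chosen to make the doubling constant exactly `⌊2 ^ D⌋`
(`Tower.doublingDimLE`, `Tower.le_two_rpow_of_doublingDimLE`). Any finite metric is a graph metric.

A gadget has clients, facilities and a far point, and a facility serves a client at cost `1` if they
are near and at cost `3` otherwise, whatever `z` is. For solutions with one centre in each main copy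
the cost is a sum over the copies, and for facilities as centres coreset points other
than clients only add a constant, as long as no centre is a coreset point (`exists_copywiseCoreset`,
`CopywiseCoreset.sum_weighted_facility`).

If `ε` is bounded below, a gadget has about `D / 4` clients and facilities for all subsets of them.
A coreset with few points does not distinguish a facility near all clients from one near
the coreset clients only, although the costs differ by a factor close to `3`; this rules out every
`ε < 1 / 2` by a margin (`card_ge_of_allSubsets`). The margin vanishes as `ε` tends to `1 / 2`,
but a coreset of clients is also tested by the far point, which bounds its total weight from below,
and by facilities near all but the coreset clients, which bound it from above
(`card_ge_of_allSubsets_of_clients`).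

If `ε` is small, the clients of a gadget form `d`, about `D / 20`, blocks of size `m`, of the
order of `ε ^ (-2)`. By `exists_signs_large_products` there are `128 m` sign vectors of length
`m` of which a fixed fraction has inner product at least `√m / 4` in absolute value with every real
vector that has most entries equal to `1`, whatever the other entries are. Such vectors are the residual weights
`1 - u` of the clients in a block that contains few coreset points. A facility is near the
clients where one of these sign vectors, common to all blocks, agrees with a sign chosen for the
block. Aligning the block signs gives two solutions for which the coreset errors differ by the order
of `k d √m`, more than `ε` times the cost `k d m` allows (`CopywiseCoreset.card_ge_of_signBlocks`).
There are about `128 m d 2 ^ d` facilities, and `D ≥ 5 log (1 / ε)` makes this less than `2 ^ D`.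

The sign vectors exist by counting. For a fixed set `Ω` of exceptional entries and fixed signs on
`Ω`, the unknown entries matter only through the signs of their inner products with the vectors
restricted to `Ω`; by the Sauer-Shelah lemma there are few patterns of such signs
(`card_negPatterns_le`). For each pattern, the random signs off `Ω` comply at a fixed fraction of
the vectors except with exponentially small probability (`card_few_aligned_le`), by second and
fourth moments (`two_pow_le_card_sum_sgn`).
-/

open Finset

/-! ### Towers of copies and their doubling dimension -/

/-- Every metric space is a graph metric: the complete graph whose edges are as long as the
distances between their ends. -/
theorem isGraphMetric_of_metricSpace (V : Type*) [MetricSpace V] : IsGraphMetric V := by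
  refine ⟨⊤, Sym2.lift ⟨fun u v => dist u v, fun u v => dist_comm u v⟩, ?_, ?_⟩
  · intro e
    induction e using Sym2.ind with
    | _ u v => simp
  · intro u v
    constructor
    · by_cases h : u = v
      · subst h
        exact ⟨SimpleGraph.Walk.nil, by simp⟩
      · exact ⟨SimpleGraph.Walk.cons (v := v) (by simpa using h) SimpleGraph.Walk.nil, by simp⟩
    · rintro _ ⟨p, rfl⟩
      induction p with
      | nil => simp
      | @cons a b c h p ih =>
        simp only [SimpleGraph.Walk.edges_cons, List.map_cons, List.sum_cons, Sym2.lift_mk]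
        linarith [dist_triangle a b c]

/-- The diameter of `W` is at most `6`. -/
class DiamLESix (W : Type*) [MetricSpace W] : Prop where
  dist_le : ∀ x y : W, dist x y ≤ 6

/-- `k` main copies and `n` spare copies of the space `W`. -/
@[ext] structure Tower (k n : ℕ) (W : Type*) where
  /-- The copy in which the point lies; the spare copies are on the right. -/
  copy : Fin k ⊕ Fin n
  /-- The position of the point in its copy. -/
  pos : W

namespace Tower

/-- The level of a copy: the `i`-th main copy is at level `i`, all spare copies are at level `k`. -/
def level {k n : ℕ} : Fin k ⊕ Fin n → ℕ
  | .inl i => i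
  | .inr _ => k

/-- The distance between two copies, the higher of which is at level `l`. -/
noncomputable def scale (l : ℕ) : ℝ := 16 * 4 ^ l

lemma le_scale (l : ℕ) : 16 ≤ scale l := by
  have : (1 : ℝ) ≤ 4 ^ l := one_le_pow₀ (by norm_num)
  unfold scale; linarith

lemma scale_mono : Monotone scale := fun a b h => by
  unfold scale
  have : (4 : ℝ) ^ a ≤ 4 ^ b := pow_le_pow_right₀ (by norm_num) h
  linarith

lemma scale_le_half {a b : ℕ} (h : a < b) : scale a ≤ scale b / 2 := by
  have h1 : scale (a + 1) ≤ scale b := scale_mono h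
  have h2 : scale (a + 1) = 4 * scale a := by unfold scale; ring
  linarith [le_scale a]

variable {k n : ℕ} {W : Type*}

/-- The two maps are inverse to each other. -/
def equivProd : Tower k n W ≃ (Fin k ⊕ Fin n) × W where
  toFun u := (u.copy, u.pos)
  invFun u := ⟨u.1, u.2⟩
  left_inv _ := rfl
  right_inv _ := rfl

noncomputable instance [Fintype W] : Fintype (Tower k n W) := Fintype.ofEquiv _ equivProd.symm

lemma sum_univ [Fintype W] (g : Tower k n W → ℝ) :
    ∑ u, g u = ∑ i : Fin k, ∑ x, g ⟨.inl i, x⟩ + ∑ j : Fin n, ∑ x, g ⟨.inr j, x⟩ := by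
  rw [← equivProd.symm.sum_comp, Fintype.sum_prod_type, Fintype.sum_sum_type]
  rfl

variable [MetricSpace W] [DiamLESix W]

open Classical in
/-- Inside a copy the distance is that of `W`; between copies it depends only on the higher level,
and grows geometrically with it. -/
noncomputable instance : MetricSpace (Tower k n W) where
  dist u v := if u.copy = v.copy then dist u.pos v.pos
    else scale (max (level u.copy) (level v.copy))
  dist_self u := by simp
  dist_comm u v := by
    simp only [eq_comm (a := u.copy), dist_comm u.pos, max_comm (level u.copy)]
  dist_triangle u v w := by
    have h6 := DiamLESix.dist_le u.pos w.pos
    have ht := dist_triangle u.pos v.pos w.pos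
    have huv := dist_nonneg (x := u.pos) (y := v.pos)
    have hvw := dist_nonneg (x := v.pos) (y := w.pos)
    have e1 := le_scale (max (level u.copy) (level v.copy))
    have e2 := le_scale (max (level v.copy) (level w.copy))
    by_cases h1 : u.copy = v.copy <;> by_cases h2 : v.copy = w.copy
    · simp [h1, h2, ht]
    · simp [h1, h2, huv]
    · simp [← h2, h1, hvw]
    · rw [if_neg h1, if_neg h2]
      split_ifs with h3
      · linarith
      · rcases le_total (level u.copy) (level w.copy) with h | h
        · have := scale_mono (show max (level u.copy) (level w.copy) ≤
            max (level v.copy) (level w.copy) by simp [h])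
          linarith
        · have := scale_mono (show max (level u.copy) (level w.copy) ≤
            max (level u.copy) (level v.copy) by simp [h])
          linarith
  eq_of_dist_eq_zero {u v} h := by
    change (if u.copy = v.copy then dist u.pos v.pos
      else scale (max (level u.copy) (level v.copy))) = 0 at h
    split_ifs at h with h1
    · exact Tower.ext h1 (eq_of_dist_eq_zero h)
    · linarith [le_scale (max (level u.copy) (level v.copy))]

lemma dist_same (c : Fin k ⊕ Fin n) (x y : W) :
    dist (⟨c, x⟩ : Tower k n W) ⟨c, y⟩ = dist x y := if_pos rfl

lemma dist_of_ne {c d : Fin k ⊕ Fin n} (h : c ≠ d) (x y : W) :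
    dist (⟨c, x⟩ : Tower k n W) ⟨d, y⟩ = scale (max (level c) (level d)) := if_neg h

lemma dist_le_scale (u v : Tower k n W) :
    dist u v ≤ scale (max (level u.copy) (level v.copy)) := by
  obtain ⟨c, x⟩ := u
  obtain ⟨d, y⟩ := v
  by_cases h : c = d
  · subst h
    rw [dist_same]
    linarith [DiamLESix.dist_le x y, le_scale (max (level c) (level c))]
  · rw [dist_of_ne h]

/-- If `r` is below the distance from copy `c` to the other copies, then the ball lies in `c`. -/
lemma copy_eq_of_dist_lt {u v : Tower k n W} {r : ℝ} (h : dist v u ≤ r)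
    (hr : r < scale (level u.copy) ∨ r < scale (level v.copy)) : v.copy = u.copy := by
  by_contra hne
  obtain ⟨c, x⟩ := u
  obtain ⟨d, y⟩ := v
  rw [dist_of_ne hne] at h
  have h1 := scale_mono (le_max_left (level d) (level c))
  have h2 := scale_mono (le_max_right (level d) (level c))
  rcases hr with hr | hr <;> simp only at hr <;> linarith

theorem doublingDimLE [Fintype W] (w₀ : W) (hk : 1 ≤ k) (hn : 1 ≤ n)
    (hW : Fintype.card W ≤ n + 1) {d : ℝ} (hd : (n : ℝ) + 1 ≤ 2 ^ d) :
    DoublingDimLE (Tower k n W) d := by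
  classical
  intro u r hr
  suffices h : ∃ t : Finset (Tower k n W), t.card ≤ n + 1 ∧
      ∀ v, dist v u ≤ r → ∃ y ∈ t, dist v y ≤ r / 2 by
    obtain ⟨t, ht, hcov⟩ := h
    refine ⟨t, le_trans (by exact_mod_cast ht) hd, fun v hv => ?_⟩
    obtain ⟨y, hy, hvy⟩ := hcov v hv
    simp only [Set.mem_iUnion]
    exact ⟨y, hy, hvy⟩
  let i₀ : Fin k := ⟨0, hk⟩
  by_cases hbig : scale k ≤ r
  · -- The `n` spare copies and the union of the main copies all have diameter at most `r / 2`.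
    refine ⟨univ.image (fun o : Option (Fin n) => (⟨o.elim (.inl i₀) .inr, w₀⟩ : Tower k n W)),
      card_image_le.trans (by simp), ?_⟩
    rintro ⟨c | c, x⟩ -
    · refine ⟨⟨.inl i₀, w₀⟩, mem_image.2 ⟨none, mem_univ _, rfl⟩, (dist_le_scale _ _).trans ?_⟩
      have : max (level (n := n) (.inl c)) (level (n := n) (.inl i₀)) < k := by
        simp [level]
      linarith [scale_le_half this]
    · refine ⟨⟨.inr c, w₀⟩, mem_image.2 ⟨some c, mem_univ _, rfl⟩, ?_⟩
      rw [dist_same]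
      linarith [DiamLESix.dist_le x w₀, le_scale k]
  push Not at hbig
  by_cases hcopy : r < scale (level u.copy)
  · -- The ball stays inside one copy, which has few points.
    refine ⟨univ.image (fun x : W => ⟨u.copy, x⟩), card_image_le.trans (by simpa using hW), ?_⟩
    intro v hv
    refine ⟨v, mem_image.2 ⟨v.pos, mem_univ _, ?_⟩, by simp; linarith⟩
    rw [← copy_eq_of_dist_lt hv (.inl hcopy)]
  push Not at hcopy
  -- `i` is the highest level of a copy that the ball can meet.
  obtain ⟨i, hir, hi⟩ : ∃ i, scale i ≤ r ∧ r < scale (i + 1) := by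
    have hex : ∃ i, r < scale i := ⟨k, hbig⟩
    have h0 : Nat.find hex ≠ 0 := fun h => by
      have := Nat.find_spec hex
      rw [h] at this
      linarith [scale_mono (Nat.zero_le (level u.copy))]
    refine ⟨Nat.find hex - 1, not_lt.1 (Nat.find_min hex (by omega)), ?_⟩
    rw [Nat.sub_add_cancel (by omega)]
    exact Nat.find_spec hex
  have hik : i < k := by
    by_contra h
    linarith [scale_mono (not_lt.1 h)]
  refine ⟨{⟨.inl ⟨i, hik⟩, w₀⟩, ⟨.inl i₀, w₀⟩}, card_le_two.trans (by omega), ?_⟩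
  intro v hv
  have hvr : scale (level v.copy) ≤ r := by
    by_contra h
    rw [copy_eq_of_dist_lt hv (.inr (not_le.1 h))] at h
    exact h hcopy
  have hvi : level v.copy ≤ i := by
    by_contra h
    have := scale_mono (show i + 1 ≤ level v.copy by omega)
    linarith
  have h16 := le_scale i
  obtain ⟨c | c, x⟩ := v
  · by_cases hci : (c : ℕ) = i
    · refine ⟨⟨.inl ⟨i, hik⟩, w₀⟩, by simp, ?_⟩
      rw [show c = ⟨i, hik⟩ from Fin.ext hci, dist_same]
      linarith [DiamLESix.dist_le x w₀]
    · refine ⟨⟨.inl i₀, w₀⟩, by simp, (dist_le_scale _ _).trans ?_⟩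
      have : max (level (n := n) (.inl c)) (level (n := n) (.inl i₀)) < i := by
        simp only [level] at hvi ⊢
        simp [i₀]
        omega
      linarith [scale_le_half this]
  · exfalso
    simp only [level] at hvi
    omega

/-- The whole space is a ball whose radius is the top scale, and no ball of half that radius meets
two of its `n + 1` parts: the spare copies and the union of the main copies. -/
theorem le_two_rpow_of_doublingDimLE (w₀ : W) (hk : 1 ≤ k) {d : ℝ}
    (h : DoublingDimLE (Tower k n W) d) : (n : ℝ) + 1 ≤ 2 ^ d := by
  let i₀ : Fin k := ⟨0, hk⟩
  let part : Option (Fin n) → Tower k n W := fun o => ⟨o.elim (.inl i₀) .inr, w₀⟩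
  obtain ⟨t, ht, hcov⟩ := h (part none) (scale k) (by linarith [le_scale k])
  have hmem : ∀ o, ∃ y ∈ t, dist (part o) y ≤ scale k / 2 := by
    intro o
    have hlev : ∀ c : Fin k ⊕ Fin n, level c ≤ k := by
      rintro (c | c) <;> simp [level]
    have : part o ∈ Metric.closedBall (part none) (scale k) :=
      (dist_le_scale _ _).trans (scale_mono (max_le (hlev _) (hlev _)))
    simpa using hcov this
  choose y hyt hy using hmem
  have hinj : Function.Injective y := by
    have key : ∀ (o : Option (Fin n)) (j : Fin n), y o = y (some j) → o = some j := by
      intro o j hoj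
      by_contra hne
      have h1 : (part o).copy ≠ .inr j := by
        rcases o with - | o
        · simp [part]
        · simpa [part] using hne
      have h2 : (y (some j)).copy = .inr j := by
        have := copy_eq_of_dist_lt (u := y (some j)) (v := part (some j)) (hy _)
          (.inr (by simp only [part, Option.elim, level]; linarith [le_scale k]))
        exact this.symm
      have h3 := copy_eq_of_dist_lt (u := y (some j)) (v := part o) (hoj ▸ hy o)
        (.inl (by rw [h2]; simp only [level]; linarith [le_scale k]))
      exact h1 (h3.trans h2)
    intro o o' hoo
    rcases o with - | o
    · rcases o' with - | o'
      · rfl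
      · exact key _ _ hoo
    · exact (key _ _ hoo.symm).symm
  have hcard : n + 1 ≤ t.card := by
    have := card_le_card_of_injOn (s := (univ : Finset (Option (Fin n)))) y
      (fun o _ => hyt o) hinj.injOn
    simpa using this
  calc (n : ℝ) + 1 ≤ t.card := by exact_mod_cast hcard
    _ ≤ _ := ht

theorem isDoublingDim [Fintype W] (w₀ : W) (hk : 1 ≤ k) (hn : 1 ≤ n)
    (hW : Fintype.card W ≤ n + 1) {d : ℝ} (hd : (n : ℝ) + 1 = 2 ^ d) :
    IsDoublingDim (Tower k n W) d := by
  refine ⟨doublingDimLE w₀ hk hn hW hd.le, fun d' hd' => ?_⟩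
  have := le_two_rpow_of_doublingDimLE w₀ hk hd'
  rw [hd] at this
  exact (Real.rpow_le_rpow_left_iff (by norm_num)).1 this

end Tower

/-! ### The gadget -/

/-- Clients `I`, facilities `F` and one far point, `none`. It is a type of its own to carry the
metric given by the sets `near f` of the clients close to the facility `f`. -/
def Gadget {I F : Type} (_z : ℕ) (_near : F → Finset I) : Type := Option (I ⊕ F)

namespace Gadget

variable {I F : Type} {z : ℕ} {near : F → Finset I}

/-- The client `p`. -/
def client (p : I) : Gadget z near := some (.inl p)

/-- The facility `f`. -/
def facility (f : F) : Gadget z near := some (.inr f)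

/-- The far point. -/
def far : Gadget z near := none

instance [Fintype I] [Fintype F] : Fintype (Gadget z near) :=
  inferInstanceAs (Fintype (Option (I ⊕ F)))

lemma card [Fintype I] [Fintype F] :
    Fintype.card (Gadget z near) = Fintype.card I + Fintype.card F + 1 := by
  change Fintype.card (Option (I ⊕ F)) = _
  simp

lemma sum_univ [Fintype I] [Fintype F] (g : Gadget z near → ℝ) :
    ∑ x, g x = g far + (∑ p, g (client p) + ∑ f, g (facility f)) := by
  have h := Fintype.sum_option (α := I ⊕ F) g
  rw [Fintype.sum_sum_type] at h
  exact h

lemma client_injective : Function.Injective (client : I → Gadget z near) :=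
  (Option.some_injective _).comp Sum.inl_injective

/-- The distance whose `z`-th power is `3`. -/
noncomputable def distThree (z : ℕ) : ℝ := (3 : ℝ) ^ ((z : ℝ)⁻¹)

lemma distThree_pow (hz : 1 ≤ z) : distThree z ^ z = 3 :=
  Real.rpow_inv_natCast_pow (by norm_num) (by omega)

lemma one_le_distThree : 1 ≤ distThree z :=
  Real.one_le_rpow (by norm_num) (by positivity)

lemma distThree_le : distThree z ≤ 3 := by
  rcases Nat.eq_zero_or_pos z with rfl | hz
  · norm_num [distThree]
  · calc distThree z ≤ (3 : ℝ) ^ (1 : ℝ) := by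
          refine Real.rpow_le_rpow_of_exponent_le (by norm_num) (inv_le_one_of_one_le₀ ?_)
          exact_mod_cast hz
      _ = 3 := by norm_num

open Classical in
/-- Between distinct points: `2` for two clients or two facilities, `6` for the far point, and `1`
or `distThree z` for a client and a facility, according to whether they are near. -/
noncomputable def distFun (z : ℕ) (near : F → Finset I) : Option (I ⊕ F) → Option (I ⊕ F) → ℝ
  | none, none => 0
  | none, some _ => 6
  | some _, none => 6
  | some (.inl p), some (.inl q) => if p = q then 0 else 2
  | some (.inr f), some (.inr g) => if f = g then 0 else 2
  | some (.inl p), some (.inr f) => if p ∈ near f then 1 else distThree z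
  | some (.inr f), some (.inl p) => if p ∈ near f then 1 else distThree z

noncomputable instance : MetricSpace (Gadget z near) where
  dist := distFun z near
  dist_self := by rintro (_ | _ | _) <;> simp [distFun]
  dist_comm := by
    rintro (_ | p | f) (_ | q | g) <;> simp only [distFun] <;> (try split_ifs) <;>
      first | rfl | (exfalso; subst_vars; simp_all)
  dist_triangle := by
    have h1 := one_le_distThree (z := z)
    have h3 := distThree_le (z := z)
    rintro (_ | p | f) (_ | q | g) (_ | r | h) <;> simp only [distFun] <;>
      (try split_ifs) <;> first | linarith | (exfalso; subst_vars; simp_all)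
  eq_of_dist_eq_zero := by
    have h1 := one_le_distThree (z := z)
    intro x y (h : distFun z near x y = 0)
    rcases x with (_ | p | f) <;> rcases y with (_ | q | g) <;> simp only [distFun] at h <;>
      first
      | rfl
      | (split_ifs at h <;> first | linarith | (subst_vars; rfl))
      | (norm_num at h)

instance : DiamLESix (Gadget z near) where
  dist_le := by
    have h3 := distThree_le (z := z)
    intro x y
    change distFun z near x y ≤ 6
    rcases x with (_ | p | f) <;> rcases y with (_ | q | g) <;> simp only [distFun] <;>
      (try split_ifs) <;> linarith

lemma dist_client_facility_pow (hz : 1 ≤ z) [DecidableEq I] (p : I) (f : F) :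
    dist (client p : Gadget z near) (facility f) ^ z = if p ∈ near f then 1 else 3 := by
  change distFun z near (some (.inl p)) (some (.inr f)) ^ z = _
  simp only [distFun]
  split_ifs <;> simp [distThree_pow hz]

lemma dist_facility_facility {f g : F} (h : f ≠ g) :
    dist (facility f : Gadget z near) (facility g) = 2 := by
  change distFun z near (some (.inr f)) (some (.inr g)) = _
  simp [distFun, h]

lemma dist_client_far (p : I) : dist (client p : Gadget z near) far = 6 := rfl

lemma dist_far_facility (f : F) : dist (far : Gadget z near) (facility f) = 6 := rfl

end Gadget

/-! ### Restricting a coreset to the copies -/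

namespace Tower

variable {k n : ℕ} {W : Type*}

lemma main_injective (f : Fin k → W) :
    Function.Injective fun i => (⟨.inl i, f i⟩ : Tower k n W) :=
  fun i j h => by simpa using congrArg copy h

/-- One centre in each main copy. -/
def centres (n : ℕ) (f : Fin k → W) : Finset (Tower k n W) :=
  univ.map ⟨_, main_injective f⟩

lemma card_centres (f : Fin k → W) : (centres n f).card = k := by simp [centres]

variable [MetricSpace W] [DiamLESix W]

lemma clusterCost_eq {z : ℕ} {S : Finset (Tower k n W)} {u s : Tower k n W} (hs : s ∈ S)
    (h : ∀ t ∈ S, dist u s ≤ dist u t) : clusterCost z u S = dist u s ^ z := by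
  have : Nonempty S := ⟨⟨s, hs⟩⟩
  refine le_antisymm ?_ ?_
  · exact ciInf_le (f := fun t : S => dist u t ^ z)
      ⟨0, by rintro _ ⟨t, rfl⟩; positivity⟩ ⟨s, hs⟩
  · exact le_ciInf fun t => pow_le_pow_left₀ dist_nonneg (h t t.2) z

lemma clusterCost_centres_inl (z : ℕ) (f : Fin k → W) (i : Fin k) (x : W) :
    clusterCost z (⟨.inl i, x⟩ : Tower k n W) (centres n f) = dist x (f i) ^ z := by
  rw [clusterCost_eq (s := ⟨.inl i, f i⟩) (by simp [centres]), dist_same]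
  intro t ht
  simp only [centres, mem_map, mem_univ, true_and, Function.Embedding.coeFn_mk] at ht
  obtain ⟨j, rfl⟩ := ht
  by_cases hij : i = j
  · subst hij; rfl
  · rw [dist_same, dist_of_ne (by simpa using hij)]
    linarith [DiamLESix.dist_le x (f i),
      le_scale (max (level (.inl i : Fin k ⊕ Fin n)) (level (.inl j : Fin k ⊕ Fin n)))]

lemma clusterCost_centres_inr (hk : 1 ≤ k) (z : ℕ) (f : Fin k → W) (j : Fin n) (x : W) :
    clusterCost z (⟨.inr j, x⟩ : Tower k n W) (centres n f) = scale k ^ z := by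
  have h : ∀ i : Fin k, dist (⟨.inr j, x⟩ : Tower k n W) ⟨.inl i, f i⟩ = scale k := fun i => by
    rw [dist_of_ne (by simp)]
    simp [level, i.2.le]
  rw [clusterCost_eq (s := ⟨.inl ⟨0, hk⟩, f ⟨0, hk⟩⟩) (by simp [centres]), h]
  intro t ht
  simp only [centres, mem_map, mem_univ, true_and, Function.Embedding.coeFn_mk] at ht
  obtain ⟨i, rfl⟩ := ht
  rw [h, h]

end Tower

section Reduction

variable {k n z : ℕ} {I F : Type} [Fintype I] [Fintype F] {near : F → Finset I}

omit [Fintype I] [Fintype F] in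
lemma client_injective : Function.Injective fun q : Fin k × I =>
    (⟨.inl q.1, Gadget.client q.2⟩ : Tower k n (Gadget z near)) := fun q q' h => by
  have h1 := congrArg Tower.copy h
  have h2 := Gadget.client_injective (congrArg Tower.pos h)
  exact Prod.ext (by simpa using h1) h2

/-- The clients of all main copies. -/
def allClients (k n z : ℕ) {I F : Type} [Fintype I] (near : F → Finset I) :
    Finset (Tower k n (Gadget z near)) :=
  (univ : Finset (Fin k × I)).map ⟨_, client_injective⟩

/-- What a coreset amounts to for solutions with one centre in each main copy: its points in copy
`i` form the set `Ω i`, with the weights `u i`, and the spare copies only change the offset. -/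
structure CopywiseCoreset (k z : ℕ) (near : F → Finset I) (ε : ℝ) where
  /-- The coreset points in each copy. -/
  Ω : Fin k → Finset (Gadget z near)
  /-- The weights in each copy. -/
  u : Fin k → Gadget z near → ℝ
  /-- The offset. -/
  K : ℝ
  nonneg : ∀ i x, 0 ≤ u i x
  eq_zero : ∀ i, ∀ x ∉ Ω i, u i x = 0
  abs_sub_le : ∀ f : Fin k → Gadget z near,
    |∑ i, ∑ p, dist (Gadget.client p) (f i) ^ z - (K + ∑ i, ∑ x, u i x * dist x (f i) ^ z)|
      ≤ ε * ∑ i, ∑ p, dist (Gadget.client p) (f i) ^ z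

theorem exists_copywiseCoreset (hk : 1 ≤ k) {ε : ℝ}
    {Ω : Finset (Tower k n (Gadget z near))} {w : Tower k n (Gadget z near) → ℝ} {Δ : ℝ}
    (h : IsCoreset ε k z (allClients k n z near) Ω w Δ) :
    ∃ C : CopywiseCoreset k z near ε, ∑ i, #(C.Ω i) ≤ #Ω ∧
      (Ω ⊆ allClients k n z near → ∀ i, ∀ x ∈ C.Ω i, ∃ p, x = Gadget.client p) := by
  classical
  obtain ⟨hw, hS⟩ := h
  let e : Fin k → Gadget z near → Tower k n (Gadget z near) := fun i x => ⟨.inl i, x⟩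
  have hsum : ∀ f : Fin k → Gadget z near, ∑ q ∈ Ω, w q * clusterCost z q (Tower.centres n f) =
      ∑ i, ∑ x, (if e i x ∈ Ω then w (e i x) else 0) * dist x (f i) ^ z +
      (∑ j : Fin n, ∑ x : Gadget z near,
        if (⟨.inr j, x⟩ : Tower k n _) ∈ Ω then w ⟨.inr j, x⟩ else 0) * Tower.scale k ^ z := by
    intro f
    have : ∑ q ∈ Ω, w q * clusterCost z q (Tower.centres n f) =
        ∑ q, (if q ∈ Ω then w q else 0) * clusterCost z q (Tower.centres n f) := by
      simp only [ite_mul, zero_mul]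
      rw [← sum_filter, filter_mem_eq_inter, univ_inter]
    rw [this, Tower.sum_univ]
    simp only [Tower.clusterCost_centres_inl, Tower.clusterCost_centres_inr hk, sum_mul]
    rfl
  have hP : ∀ f : Fin k → Gadget z near,
      ∑ q ∈ allClients k n z near, clusterCost z q (Tower.centres n f) =
      ∑ i, ∑ p, dist (Gadget.client p) (f i) ^ z := by
    intro f
    rw [allClients, sum_map, ← univ_product_univ, sum_product]
    simp only [Function.Embedding.coeFn_mk, Tower.clusterCost_centres_inl]
  refine ⟨⟨fun i => {x | e i x ∈ Ω}, fun i x => if e i x ∈ Ω then w (e i x) else 0,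
    Δ + (∑ j : Fin n, ∑ x : Gadget z near,
      if (⟨.inr j, x⟩ : Tower k n _) ∈ Ω then w ⟨.inr j, x⟩ else 0) * Tower.scale k ^ z,
    ?_, ?_, ?_⟩, ?_, ?_⟩
  · intro i x
    split_ifs with hx
    · exact hw _ hx
    · exact le_rfl
  · intro i x hx
    simp only [mem_filter, mem_univ, true_and] at hx
    exact if_neg hx
  · intro f
    have := hS (Tower.centres n f) (Tower.card_centres f)
    rw [hP, hsum] at this
    convert this using 3
    ring
  · have : ∑ i : Fin k, #({x | e i x ∈ Ω} : Finset (Gadget z near)) =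
        #((univ : Finset (Fin k)).sigma fun i => ({x | e i x ∈ Ω} : Finset (Gadget z near))) := by
      rw [card_sigma]
    rw [this]
    refine card_le_card_of_injOn (fun q => e q.1 q.2) ?_ ?_
    · intro q hq
      simpa using hq
    · rintro ⟨i, x⟩ _ ⟨j, y⟩ _ hq
      have h1 := congrArg Tower.copy hq
      have h2 := congrArg Tower.pos hq
      simp only [e, Sum.inl.injEq] at h1 h2
      subst h1 h2
      rfl
  · intro hΩ i x hx
    simp only [mem_filter, mem_univ, true_and] at hx
    have := hΩ hx
    simp only [allClients, mem_map, mem_univ, true_and, Function.Embedding.coeFn_mk] at this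
    obtain ⟨q, hq⟩ := this
    exact ⟨q.2, (congrArg Tower.pos hq).symm⟩

end Reduction

/-- The sign vector of a set: `1` on the set and `-1` off it. -/
noncomputable def sgn {ι : Type*} [DecidableEq ι] (A : Finset ι) (p : ι) : ℝ :=
  if p ∈ A then 1 else -1

/-! ### Moments of sums of signs -/

section Moments

variable {ι : Type*} [DecidableEq ι]

lemma sum_sgn_insert_left {a : ι} {T A : Finset ι} (ha : a ∉ T) (hA : A ⊆ T) :
    ∑ p ∈ insert a T, sgn A p = ∑ p ∈ T, sgn A p - 1 := by
  rw [sum_insert ha, sgn, if_neg fun h => ha (hA h)]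
  ring

lemma sum_sgn_insert_right {a : ι} {T : Finset ι} (A : Finset ι) (ha : a ∉ T) :
    ∑ p ∈ insert a T, sgn (insert a A) p = ∑ p ∈ T, sgn A p + 1 := by
  rw [sum_insert ha, sgn, if_pos (mem_insert_self a A), add_comm]
  congr 1
  refine sum_congr rfl fun p hp => ?_
  have : p ≠ a := fun h => ha (h ▸ hp)
  simp [sgn, this]

lemma sum_powerset_sum_sgn_insert {a : ι} {T : Finset ι} (ha : a ∉ T) (f : ℝ → ℝ) :
    ∑ A ∈ (insert a T).powerset, f (∑ p ∈ insert a T, sgn A p) =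
      ∑ A ∈ T.powerset,
        (f (∑ p ∈ T, sgn A p - 1) + f (∑ p ∈ T, sgn A p + 1)) := by
  rw [sum_powerset_insert ha, sum_add_distrib]
  congr 1
  · exact sum_congr rfl fun A hA => by rw [sum_sgn_insert_left ha (mem_powerset.1 hA)]
  · exact sum_congr rfl fun A _ => by rw [sum_sgn_insert_right A ha]

lemma sum_sq_sum_sgn (T : Finset ι) :
    ∑ A ∈ T.powerset, (∑ p ∈ T, sgn A p) ^ 2 = (2 : ℝ) ^ #T * #T := by
  induction T using Finset.induction_on with
  | empty => simp
  | insert a T ha ih =>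
    rw [sum_powerset_sum_sgn_insert ha (fun x => x ^ 2), card_insert_of_notMem ha]
    calc _ = ∑ A ∈ T.powerset, (2 * (∑ p ∈ T, sgn A p) ^ 2 + 2) :=
          sum_congr rfl fun A _ => by ring
      _ = _ := by
          rw [sum_add_distrib, ← mul_sum, ih]
          simp
          ring

lemma sum_pow_four_sum_sgn (T : Finset ι) :
    ∑ A ∈ T.powerset, (∑ p ∈ T, sgn A p) ^ 4 = (2 : ℝ) ^ #T * (3 * #T ^ 2 - 2 * #T) := by
  induction T using Finset.induction_on with
  | empty => simp
  | insert a T ha ih =>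
    rw [sum_powerset_sum_sgn_insert ha (fun x => x ^ 4), card_insert_of_notMem ha]
    calc _ = ∑ A ∈ T.powerset, (2 * (∑ p ∈ T, sgn A p) ^ 4 +
            12 * (∑ p ∈ T, sgn A p) ^ 2 + 2) :=
          sum_congr rfl fun A _ => by ring
      _ = _ := by
          rw [sum_add_distrib, sum_add_distrib, ← mul_sum, ← mul_sum, ih, sum_sq_sum_sgn]
          simp
          ring

lemma sgn_sdiff {T A : Finset ι} {p : ι} (hp : p ∈ T) : sgn (T \ A) p = -sgn A p := by
  by_cases h : p ∈ A <;> simp [sgn, h, hp]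

lemma card_sum_sgn_le_neg (T : Finset ι) (r : ℝ) :
    #{A ∈ T.powerset | ∑ p ∈ T, sgn A p ≤ -r} = #{A ∈ T.powerset | r ≤ ∑ p ∈ T, sgn A p} := by
  have hneg : ∀ A, ∑ p ∈ T, sgn (T \ A) p = -∑ p ∈ T, sgn A p := fun A => by
    rw [← sum_neg_distrib]
    exact sum_congr rfl fun p hp => sgn_sdiff hp
  refine card_bij' (fun A _ => T \ A) (fun A _ => T \ A) ?_ ?_ ?_ ?_
  · intro A hA
    rw [mem_filter] at hA ⊢
    refine ⟨mem_powerset.2 sdiff_subset, ?_⟩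
    rw [hneg]; linarith [hA.2]
  · intro A hA
    rw [mem_filter] at hA ⊢
    refine ⟨mem_powerset.2 sdiff_subset, ?_⟩
    rw [hneg]; linarith [hA.2]
  · intro A hA
    simpa using (mem_powerset.1 (mem_filter.1 hA).1)
  · intro A hA
    simpa using (mem_powerset.1 (mem_filter.1 hA).1)

/-- A sum of `n` random signs is at least half its standard deviation with probability at least
`1 / 12`. -/
lemma two_pow_le_card_sum_sgn (T : Finset ι) (hT : T.Nonempty) {r : ℝ}
    (hrT : 4 * r ^ 2 ≤ #T) :
    (2 : ℝ) ^ #T ≤ 12 * #{A ∈ T.powerset | r ≤ ∑ p ∈ T, sgn A p} := by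
  have hn : (1 : ℝ) ≤ #T := by exact_mod_cast hT.card_pos
  set n : ℝ := (#T : ℝ)
  set S : Finset ι → ℝ := fun A => ∑ p ∈ T, sgn A p with hS
  set c : ℝ := (#{A ∈ T.powerset | r ≤ S A} : ℝ) with hc
  -- Average the quadratic polynomial `(y - n / 4) (5 n - y)`, `y = S ^ 2`, which is nonpositive
  -- for `y ≤ n / 4` and never exceeds `(19 n / 8) ^ 2`.
  have hpt : ∀ A ∈ T.powerset, (S A ^ 2 - n / 4) * (5 * n - S A ^ 2) ≤
      (19 * n / 8) ^ 2 * ((if r ≤ S A then 1 else 0) + (if S A ≤ -r then 1 else 0)) := by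
    intro A _
    have hmax : (S A ^ 2 - n / 4) * (5 * n - S A ^ 2) ≤ (19 * n / 8) ^ 2 := by
      nlinarith [sq_nonneg (2 * S A ^ 2 - 21 * n / 4)]
    have hpos := sq_nonneg (19 * n / 8)
    split_ifs with h1 h2 h2
    · linarith
    · linarith
    · linarith
    · have h3 : S A ^ 2 ≤ r ^ 2 := sq_le_sq' (by linarith) (by linarith)
      have : 0 ≤ (n / 4 - S A ^ 2) * (5 * n - S A ^ 2) :=
        mul_nonneg (by linarith) (by linarith)
      linarith
  have hsum := sum_le_sum hpt
  have hR : ∑ A ∈ T.powerset, (19 * n / 8) ^ 2 *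
      ((if r ≤ S A then (1 : ℝ) else 0) + (if S A ≤ -r then 1 else 0)) =
      (19 * n / 8) ^ 2 * (2 * c) := by
    rw [← mul_sum, sum_add_distrib, sum_boole, sum_boole, card_sum_sgn_le_neg T r]
    simp only [hc, hS]
    ring
  have hL : ∑ A ∈ T.powerset, (S A ^ 2 - n / 4) * (5 * n - S A ^ 2) =
      (2 : ℝ) ^ #T * (n ^ 2 + 2 * n) := by
    calc _ = ∑ A ∈ T.powerset, (21 * n / 4 * S A ^ 2 - S A ^ 4 - 5 * n ^ 2 / 4) :=
          sum_congr rfl fun A _ => by ring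
      _ = _ := by
          rw [sum_sub_distrib, sum_sub_distrib, ← mul_sum, sum_sq_sum_sgn, sum_pow_four_sum_sgn]
          simp
          ring
  rw [hR, hL] at hsum
  have h2 : (0 : ℝ) < 2 ^ #T := by positivity
  have hc0 : 0 ≤ c := by positivity
  have : n ^ 2 * 2 ^ #T ≤ n ^ 2 * (12 * c) := by nlinarith
  exact le_of_mul_le_mul_left this (by positivity)

end Moments

/-! ### Sign patterns of linear functionals -/

section SignPatterns

variable {ι κ : Type*} [DecidableEq ι] [Fintype κ] [DecidableEq κ]

open Classical in
/-- The sets of indices at which a linear functional takes negative values on given sign vectors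
indexed by `κ`, restricted to the coordinates in `Ω`. -/
noncomputable def negPatterns (Ω : Finset ι) (B : κ → Finset ι) : Finset (Finset κ) :=
  {Q | ∃ v : ι → ℝ, Q = ({j | ∑ p ∈ Ω, v p * sgn (B j) p < 0} : Finset κ)}

lemma vcDim_negPatterns_le (Ω : Finset ι) (B : κ → Finset ι) :
    (negPatterns Ω B).vcDim ≤ #Ω := by
  refine Finset.sup_le fun S hS => ?_
  rw [mem_shatterer] at hS
  by_contra hlt
  -- More than `#Ω` vectors are linearly dependent; a dependency forbids one of the patterns.
  let x : S → (Ω → ℝ) := fun j p => sgn (B j) p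
  have hdep : ¬ LinearIndependent ℝ x := fun h => by
    have := h.fintype_card_le_finrank
    simp at this
    omega
  obtain ⟨g, hg0, hgpos⟩ : ∃ g : S → ℝ, ∑ j, g j • x j = 0 ∧ ∃ j, 0 < g j := by
    rw [Fintype.not_linearIndependent_iff] at hdep
    obtain ⟨g, hg, j, hj⟩ := hdep
    rcases lt_or_gt_of_ne hj with h | h
    · refine ⟨fun j => -g j, ?_, j, by linarith⟩
      simp only [neg_smul, sum_neg_distrib, hg, neg_zero]
    · exact ⟨g, hg, j, h⟩
  obtain ⟨j₀, hj₀⟩ := hgpos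
  obtain ⟨Q, hQ, hQS⟩ := hS (t := ({j : S | 0 < g j} : Finset S).map (Function.Embedding.subtype _))
    (by intro j hj; simp at hj; exact hj.1)
  simp only [negPatterns, mem_filter, mem_univ, true_and] at hQ
  obtain ⟨v, rfl⟩ := hQ
  have hiff : ∀ j : S, ∑ p ∈ Ω, v p * sgn (B j) p < 0 ↔ 0 < g j := by
    intro j
    have := congrArg ((j : κ) ∈ ·) hQS
    simpa using this
  have hzero : ∑ j : S, g j * ∑ p ∈ Ω, v p * sgn (B j) p = 0 := by
    have h : ∀ p : Ω, ∑ j : S, g j * sgn (B j) p = 0 := fun p => by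
      have := congrFun hg0 p
      simpa [x] using this
    calc _ = ∑ j : S, ∑ p : Ω, g j * (v p * sgn (B j) p) := by
          refine sum_congr rfl fun j _ => ?_
          rw [mul_sum, ← sum_coe_sort Ω]
      _ = ∑ p : Ω, v p * ∑ j : S, g j * sgn (B j) p := by
          rw [sum_comm]
          refine sum_congr rfl fun p _ => ?_
          rw [mul_sum]
          exact sum_congr rfl fun j _ => by ring
      _ = 0 := sum_eq_zero fun p _ => by rw [h, mul_zero]
  have hneg : ∑ j : S, g j * ∑ p ∈ Ω, v p * sgn (B j) p < 0 := by
    refine sum_neg' (fun j _ => ?_) ⟨j₀, mem_univ _, ?_⟩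
    · by_cases hj : 0 < g j
      · exact (mul_neg_of_pos_of_neg hj ((hiff j).2 hj)).le
      · exact mul_nonpos_of_nonpos_of_nonneg (not_lt.1 hj)
          (not_lt.1 fun h => hj ((hiff j).1 h))
    · exact mul_neg_of_pos_of_neg hj₀ ((hiff j₀).2 hj₀)
  linarith

lemma sum_choose_le (J d : ℕ) :
    (∑ i ∈ Iic d, (J.choose i : ℝ)) ≤ 128 ^ d * (129 / 128) ^ J := by
  calc (∑ i ∈ Iic d, (J.choose i : ℝ))
      ≤ ∑ i ∈ Iic d, 128 ^ d * ((1 / 128) ^ i * (J.choose i : ℝ)) := by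
        refine sum_le_sum fun i hi => ?_
        have hid : i ≤ d := mem_Iic.1 hi
        have h1 : (1 : ℝ) ≤ 128 ^ d * (1 / 128) ^ i := by
          rw [one_div, inv_pow, ← div_eq_mul_inv, one_le_div (by positivity)]
          exact pow_le_pow_right₀ (by norm_num) hid
        have h2 : (0 : ℝ) ≤ J.choose i := by positivity
        nlinarith
    _ = 128 ^ d * ∑ i ∈ Iic d, (1 / 128) ^ i * (J.choose i : ℝ) := by rw [mul_sum]
    _ ≤ 128 ^ d * ∑ i ∈ range (J + 1) ∪ Iic d, (1 / 128) ^ i * (J.choose i : ℝ) := by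
        gcongr
        exact subset_union_right
    _ = 128 ^ d * ∑ i ∈ range (J + 1), (1 / 128) ^ i * (J.choose i : ℝ) := by
        congr 1
        refine (sum_subset subset_union_left fun i _ hi => ?_).symm
        rw [mem_range, not_lt] at hi
        rw [Nat.choose_eq_zero_of_lt hi]
        simp
    _ = 128 ^ d * (129 / 128) ^ J := by
        have := add_pow (1 / 128 : ℝ) 1 J
        simp only [one_pow, mul_one] at this
        rw [← this]
        norm_num

lemma card_negPatterns_le (Ω : Finset ι) (B : κ → Finset ι) :
    (#(negPatterns Ω B) : ℝ) ≤ 128 ^ #Ω * (129 / 128) ^ Fintype.card κ := by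
  have h1 : #(negPatterns Ω B) ≤ ∑ i ∈ Iic (negPatterns Ω B).vcDim, (Fintype.card κ).choose i :=
    (card_le_card_shatterer _).trans card_shatterer_le_sum_vcDim
  have h2 : ∑ i ∈ Iic (negPatterns Ω B).vcDim, (Fintype.card κ).choose i ≤
      ∑ i ∈ Iic #Ω, (Fintype.card κ).choose i :=
    sum_le_sum_of_subset (Iic_subset_Iic.2 (vcDim_negPatterns_le Ω B))
  calc (#(negPatterns Ω B) : ℝ) ≤ ((∑ i ∈ Iic #Ω, (Fintype.card κ).choose i : ℕ) : ℝ) := by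
        exact_mod_cast h1.trans h2
    _ = ∑ i ∈ Iic #Ω, ((Fintype.card κ).choose i : ℝ) := by push_cast; rfl
    _ ≤ _ := sum_choose_le _ _

end SignPatterns

/-! ### Sign vectors with large inner products -/

section Embedding

variable {m J : ℕ}

/-- The index `j` is aligned with the pattern `Q` if the signs of the row `A` off `Ω` have a sum of
absolute value at least `r`, negative for `j ∈ Q` and positive otherwise. -/
def Aligned (r : ℝ) (Ω : Finset (Fin m)) (Q : Finset (Fin J)) (j : Fin J) (A : Finset (Fin m)) :
    Prop :=
  (j ∉ Q ∧ r ≤ ∑ p ∈ Ωᶜ, sgn A p) ∨ (j ∈ Q ∧ ∑ p ∈ Ωᶜ, sgn A p ≤ -r)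

lemma sum_compl_sgn_union {Ω B : Finset (Fin m)} (hB : B ⊆ Ω) (A : Finset (Fin m)) :
    ∑ p ∈ Ωᶜ, sgn (B ∪ A) p = ∑ p ∈ Ωᶜ, sgn A p := by
  refine sum_congr rfl fun p hp => ?_
  have : p ∉ B := fun h => (mem_compl.1 hp) (hB h)
  simp [sgn, this]

lemma two_pow_le_card_aligned {r : ℝ} {Ω : Finset (Fin m)} (hΩ : Ωᶜ.Nonempty)
    (hrΩ : 4 * r ^ 2 ≤ #Ωᶜ) (Q : Finset (Fin J)) (j : Fin J) {B : Finset (Fin m)} (hB : B ⊆ Ω) :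
    open Classical in
    (2 : ℝ) ^ #Ωᶜ ≤ 12 * #{A ∈ Ωᶜ.powerset | Aligned r Ω Q j (B ∪ A)} := by
  classical
  have h := two_pow_le_card_sum_sgn Ωᶜ hΩ hrΩ
  by_cases hj : j ∈ Q
  · rw [← card_sum_sgn_le_neg] at h
    simpa [Aligned, hj, sum_compl_sgn_union hB] using h
  · simpa [Aligned, hj, sum_compl_sgn_union hB] using h

/-- The set systems that agree with `B` on `Ω`. -/
def extensions (Ω : Finset (Fin m)) (B : Fin J → Finset (Fin m)) :
    Finset (Fin J → Finset (Fin m)) :=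
  Fintype.piFinset fun j => Ωᶜ.powerset.image (B j ∪ ·)

open Classical in
/-- Among the set systems with a given restriction to `Ω`, only an exponentially small fraction is
aligned with a given pattern at few indices: the alignments are independent events of
probability at least `1 / 12`, and the claim follows by averaging `2 ^ (-#aligned)`. -/
lemma card_few_aligned_le {r : ℝ} {Ω : Finset (Fin m)} (hΩ : Ωᶜ.Nonempty)
    (hrΩ : 4 * r ^ 2 ≤ #Ωᶜ) (Q : Finset (Fin J)) {B : Fin J → Finset (Fin m)}
    (hB : ∀ j, B j ⊆ Ω) (a : ℕ) :
    (#{H ∈ extensions Ω B | #{j | Aligned r Ω Q j (H j)} ≤ a} : ℝ) ≤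
      2 ^ a * (2 ^ #Ωᶜ * (23 / 24)) ^ J := by
  set f : Fin J → Finset (Fin m) → ℝ := fun j A => if Aligned r Ω Q j A then 1 / 2 else 1 with hf
  have hf0 : ∀ j A, 0 ≤ f j A := fun j A => by simp only [hf]; split_ifs <;> norm_num
  have hrow : ∀ j, ∑ A ∈ Ωᶜ.powerset.image (B j ∪ ·), f j A ≤ 2 ^ #Ωᶜ * (23 / 24) := by
    intro j
    have hinj : Set.InjOn (B j ∪ ·) (Ωᶜ.powerset : Set (Finset (Fin m))) := by
      intro A hA A' hA' h
      have hd : ∀ A ∈ Ωᶜ.powerset, (B j ∪ A) \ Ω = A := by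
        intro A hA
        ext p
        have h1 := @hB j p
        have h2 : p ∈ A → p ∈ Ωᶜ := fun h => mem_powerset.1 hA h
        simp only [mem_sdiff, mem_union, mem_compl] at *
        tauto
      rw [← hd A hA, ← hd A' hA']
      exact congrArg (· \ Ω) h
    rw [sum_image hinj]
    have hc := two_pow_le_card_aligned hΩ hrΩ Q j (hB j)
    calc ∑ A ∈ Ωᶜ.powerset, f j (B j ∪ A)
        = ∑ A ∈ Ωᶜ.powerset, (1 - 1 / 2 * (if Aligned r Ω Q j (B j ∪ A) then 1 else 0)) := by
          refine sum_congr rfl fun A _ => ?_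
          simp only [hf]
          split_ifs <;> norm_num
      _ = 2 ^ #Ωᶜ - 1 / 2 * #{A ∈ Ωᶜ.powerset | Aligned r Ω Q j (B j ∪ A)} := by
          rw [sum_sub_distrib, ← mul_sum, sum_boole]
          simp
      _ ≤ _ := by linarith
  have hprod : ∑ H ∈ extensions Ω B, ∏ j, f j (H j) ≤ (2 ^ #Ωᶜ * (23 / 24)) ^ J := by
    rw [extensions, ← prod_univ_sum]
    calc _ ≤ ∏ _j : Fin J, (2 : ℝ) ^ #Ωᶜ * (23 / 24) :=
          prod_le_prod (fun j _ => sum_nonneg fun A _ => hf0 j A) fun j _ => hrow j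
      _ = _ := by simp
  have hlow : (#{H ∈ extensions Ω B | #{j | Aligned r Ω Q j (H j)} ≤ a} : ℝ) * (1 / 2) ^ a ≤
      ∑ H ∈ extensions Ω B, ∏ j, f j (H j) := by
    rw [← nsmul_eq_mul, ← sum_const]
    refine (sum_le_sum fun H hH => ?_).trans
      (sum_le_sum_of_subset_of_nonneg (filter_subset _ _)
        fun H _ _ => prod_nonneg fun j _ => hf0 j (H j))
    simp only [hf]
    rw [prod_ite]
    simp only [prod_const, one_pow, mul_one]
    exact pow_le_pow_of_le_one (by norm_num) (by norm_num) (mem_filter.1 hH).2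
  have h := hlow.trans hprod
  calc _ = 2 ^ a * ((#{H ∈ extensions Ω B | #{j | Aligned r Ω Q j (H j)} ≤ a} : ℝ) *
        (1 / 2) ^ a) := by
        rw [mul_comm, mul_assoc, ← mul_pow]; norm_num
    _ ≤ _ := by gcongr

open Classical in
/-- The set systems of which at most `a` sign vectors have inner product at least `r`, in absolute
value, with some vector `v` that is `1` off `Ω`. -/
noncomputable def flatSystems (J : ℕ) (r : ℝ) (a : ℕ) (Ω : Finset (Fin m)) :
    Finset (Fin J → Finset (Fin m)) :=
  {H | ∃ v : Fin m → ℝ, (∀ p ∉ Ω, v p = 1) ∧ #{j | r ≤ |∑ p, v p * sgn (H j) p|} ≤ a}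

open Classical in
/-- A vector `v` that is `1` off `Ω` enters only through the signs of its products with the
restrictions to `Ω`, and these realize few patterns. -/
lemma flatSystems_subset (r : ℝ) (a : ℕ) (Ω : Finset (Fin m)) :
    flatSystems J r a Ω ⊆ (Fintype.piFinset fun _ : Fin J => Ω.powerset).biUnion fun B =>
      (negPatterns Ω B).biUnion fun Q =>
        {H ∈ extensions Ω B | #{j | Aligned r Ω Q j (H j)} ≤ a} := by
  intro H hH
  simp only [flatSystems, mem_filter, mem_univ, true_and] at hH
  obtain ⟨v, hv, hcard⟩ := hH
  have hsplit : ∀ j, ∑ p, v p * sgn (H j) p =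
      ∑ p ∈ Ω, v p * sgn (H j ∩ Ω) p + ∑ p ∈ Ωᶜ, sgn (H j) p := by
    intro j
    rw [← sum_add_sum_compl Ω]
    congr 1
    · refine sum_congr rfl fun p hp => ?_
      simp [sgn, hp]
    · refine sum_congr rfl fun p hp => ?_
      rw [hv p (mem_compl.1 hp), one_mul]
  simp only [mem_biUnion, mem_filter]
  refine ⟨fun j => H j ∩ Ω, by simp [Fintype.mem_piFinset],
    ({j | ∑ p ∈ Ω, v p * sgn (H j ∩ Ω) p < 0} : Finset (Fin J)), ?_, ?_, ?_⟩
  · simp only [negPatterns, mem_filter, mem_univ, true_and]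
    exact ⟨v, rfl⟩
  · simp only [extensions, Fintype.mem_piFinset, mem_image, mem_powerset]
    intro j
    refine ⟨H j \ Ω, fun p hp => mem_compl.2 (mem_sdiff.1 hp).2, ?_⟩
    rw [union_comm]
    exact sdiff_union_inter _ _
  · refine (card_le_card fun j hj => ?_).trans hcard
    simp only [mem_filter, mem_univ, true_and, Aligned, not_lt] at hj ⊢
    rw [hsplit]
    rcases hj with ⟨h1, h2⟩ | ⟨h1, h2⟩
    · exact le_trans (by linarith) (le_abs_self _)
    · exact le_trans (by linarith) (neg_le_abs _)

lemma card_flatSystems_le {r : ℝ} {Ω : Finset (Fin m)} (hΩ : Ωᶜ.Nonempty)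
    (hrΩ : 4 * r ^ 2 ≤ #Ωᶜ) (a : ℕ) :
    (#(flatSystems J r a Ω) : ℝ) ≤
      128 ^ #Ω * (129 / 128) ^ J * (2 ^ a * (23 / 24) ^ J) * (2 ^ m) ^ J := by
  classical
  have hm : #Ω + #Ωᶜ = m := by rw [card_add_card_compl, Fintype.card_fin]
  calc (#(flatSystems J r a Ω) : ℝ)
      ≤ ((∑ B ∈ Fintype.piFinset fun _ : Fin J => Ω.powerset, ∑ Q ∈ negPatterns Ω B,
          #{H ∈ extensions Ω B | #{j | Aligned r Ω Q j (H j)} ≤ a} : ℕ) : ℝ) := by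
        refine Nat.cast_le.2 ((card_le_card (flatSystems_subset r a Ω)).trans ?_)
        exact card_biUnion_le.trans (sum_le_sum fun B _ => card_biUnion_le)
    _ ≤ ∑ B ∈ Fintype.piFinset fun _ : Fin J => Ω.powerset,
          128 ^ #Ω * (129 / 128) ^ J * (2 ^ a * (2 ^ #Ωᶜ * (23 / 24)) ^ J) := by
        push_cast
        refine sum_le_sum fun B hB => ?_
        have hB' : ∀ j, B j ⊆ Ω := fun j => mem_powerset.1 (Fintype.mem_piFinset.1 hB j)
        refine (sum_le_sum fun Q _ => card_few_aligned_le hΩ hrΩ Q hB' a).trans ?_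
        rw [sum_const, nsmul_eq_mul]
        have := card_negPatterns_le Ω B
        rw [Fintype.card_fin] at this
        gcongr
    _ = _ := by
        have h2 : (2 : ℝ) ^ m = 2 ^ #Ω * 2 ^ #Ωᶜ := by rw [← pow_add, hm]
        rw [sum_const, nsmul_eq_mul, Fintype.card_piFinset_const, card_powerset, h2, mul_pow,
          mul_pow]
        push_cast
        ring

/-- There are `128 m` sign vectors of length `m` such that every real vector with all but
a sixteenth of its entries equal to `1` has an inner product of order at least `√m` with at least
`2 m` of them. -/
theorem exists_signs_large_products (m : ℕ) (hm : 1 ≤ m) :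
    ∃ H : Fin (128 * m) → Finset (Fin m), ∀ v : Fin m → ℝ,
      16 * #{p | v p ≠ 1} ≤ m → 2 * m ≤ #{j | √m / 4 ≤ |∑ p, v p * sgn (H j) p|} := by
  classical
  set J := 128 * m
  by_contra hcon
  push Not at hcon
  have hcover : (univ : Finset (Fin J → Finset (Fin m))) ⊆
      ({Ω | 16 * #Ω ≤ m} : Finset (Finset (Fin m))).biUnion
        fun Ω => flatSystems J (√m / 4) (2 * m) Ω := by
    intro H _
    obtain ⟨v, hv, hc⟩ := hcon H
    simp only [mem_biUnion, mem_filter, mem_univ, true_and, flatSystems]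
    refine ⟨_, hv, v, fun p hp => by simpa using hp, hc.le⟩
  have hbound : ∀ Ω ∈ ({Ω | 16 * #Ω ≤ m} : Finset (Finset (Fin m))),
      (#(flatSystems J (√m / 4) (2 * m) Ω) : ℝ) ≤
        2 ^ m * (129 / 128) ^ J * (2 ^ (2 * m) * (23 / 24) ^ J) * (2 ^ m) ^ J := by
    intro Ω hΩ
    simp only [mem_filter, mem_univ, true_and] at hΩ
    have hc : #Ω + #Ωᶜ = m := by rw [card_add_card_compl, Fintype.card_fin]
    have hcR : (m : ℝ) ≤ 4 * #Ωᶜ := by exact_mod_cast (by omega : m ≤ 4 * #Ωᶜ)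
    refine (card_flatSystems_le (card_pos.1 (by omega)) ?_ _).trans ?_
    · rw [div_pow, Real.sq_sqrt (Nat.cast_nonneg m)]
      linarith
    · have : (128 : ℝ) ^ #Ω ≤ 2 ^ m := by
        rw [show (128 : ℝ) = 2 ^ 7 by norm_num, ← pow_mul]
        exact pow_le_pow_right₀ (by norm_num) (by omega)
      gcongr
  have htotal : ((2 : ℝ) ^ m) ^ J ≤
      2 ^ m * (2 ^ m * (129 / 128) ^ J * (2 ^ (2 * m) * (23 / 24) ^ J) * (2 ^ m) ^ J) := by
    have h1 : ((2 : ℝ) ^ m) ^ J = #(univ : Finset (Fin J → Finset (Fin m))) := by simp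
    rw [h1]
    calc (#(univ : Finset (Fin J → Finset (Fin m))) : ℝ)
        ≤ ∑ Ω ∈ ({Ω | 16 * #Ω ≤ m} : Finset (Finset (Fin m))),
            (#(flatSystems J (√m / 4) (2 * m) Ω) : ℝ) := by
          exact_mod_cast (card_le_card hcover).trans card_biUnion_le
      _ ≤ #({Ω | 16 * #Ω ≤ m} : Finset (Finset (Fin m))) •
            (2 ^ m * (129 / 128) ^ J * (2 ^ (2 * m) * (23 / 24) ^ J) * (2 ^ m) ^ J : ℝ) :=
          sum_le_card_nsmul _ _ _ hbound
      _ ≤ _ := by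
          rw [nsmul_eq_mul, ← h1]
          gcongr
          have := card_filter_le (univ : Finset (Finset (Fin m))) fun Ω => 16 * #Ω ≤ m
          rw [card_univ, Fintype.card_finset, Fintype.card_fin] at this
          exact_mod_cast this
  have hlt : (2 : ℝ) ^ m * (2 ^ m * (129 / 128) ^ J * (2 ^ (2 * m) * (23 / 24) ^ J)) < 1 := by
    have : (2 : ℝ) ^ m * (2 ^ m * (129 / 128) ^ J * (2 ^ (2 * m) * (23 / 24) ^ J)) =
        (16 * (129 / 128 * (23 / 24)) ^ 128) ^ m := by
      simp only [J, pow_mul, mul_pow]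
      rw [show (16 : ℝ) ^ m = 2 ^ m * 2 ^ m * (2 ^ 2) ^ m by
        rw [← mul_pow, ← mul_pow]; norm_num]
      ring
    rw [this]
    exact pow_lt_one₀ (by norm_num) (by norm_num) (by omega)
  have hpos : (0 : ℝ) < (2 ^ m) ^ J := by positivity
  nlinarith

end Embedding

/-! ### Costs of the facilities in one copy -/

namespace CopywiseCoreset

variable {k z : ℕ} {I F : Type} [Fintype I] [Fintype F] [DecidableEq I] {near : F → Finset I}
  {ε : ℝ}

/-- The cost in copy `i` of the coreset points other than clients; it is the same for all facilities
that carry no weight. -/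
def base (C : CopywiseCoreset k z near ε) (i : Fin k) : ℝ :=
  C.u i Gadget.far * 6 ^ z + ∑ f, C.u i (Gadget.facility f) * 2 ^ z

lemma sum_weighted_facility (C : CopywiseCoreset k z near ε) (hz : 1 ≤ z) (i : Fin k) {g : F}
    (hg : C.u i (Gadget.facility g) = 0) :
    ∑ x, C.u i x * dist x (Gadget.facility g) ^ z =
      C.base i + ∑ p, C.u i (Gadget.client p) * (if p ∈ near g then 1 else 3) := by
  rw [Gadget.sum_univ]
  simp only [Gadget.dist_client_facility_pow hz, Gadget.dist_far_facility, base]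
  have : ∑ f, C.u i (Gadget.facility f) *
        dist (Gadget.facility f : Gadget z near) (Gadget.facility g) ^ z =
      ∑ f, C.u i (Gadget.facility f) * 2 ^ z := by
    refine sum_congr rfl fun f _ => ?_
    by_cases h : f = g
    · rw [h, hg, zero_mul, zero_mul]
    · rw [Gadget.dist_facility_facility h]
  rw [this]
  ring

/-- The set of the clients of copy `i` that belong to the coreset. -/
noncomputable def clients (C : CopywiseCoreset k z near ε) (i : Fin k) : Finset I :=
  open Classical in {p | Gadget.client p ∈ C.Ω i}

omit [DecidableEq I] in
lemma card_clients_le (C : CopywiseCoreset k z near ε) (i : Fin k) : #(C.clients i) ≤ #(C.Ω i) :=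
  card_le_card_of_injOn Gadget.client (fun p hp => by simpa [clients] using hp)
    Gadget.client_injective.injOn

omit [DecidableEq I] in
lemma eq_zero_of_notMem_clients (C : CopywiseCoreset k z near ε) {i : Fin k} {p : I}
    (hp : p ∉ C.clients i) : C.u i (Gadget.client p) = 0 :=
  C.eq_zero i _ (by simpa [clients] using hp)

omit [Fintype F] in
lemma sum_dist_client_pow (hz : 1 ≤ z) (g : F) :
    ∑ p, dist (Gadget.client p : Gadget z near) (Gadget.facility g) ^ z =
      3 * Fintype.card I - 2 * #(near g) := by
  simp only [Gadget.dist_client_facility_pow hz]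
  calc ∑ p, (if p ∈ near g then (1 : ℝ) else 3) =
        ∑ p, (3 - 2 * (if p ∈ near g then (1 : ℝ) else 0)) :=
        sum_congr rfl fun p _ => by split_ifs <;> norm_num
    _ = _ := by
        rw [sum_sub_distrib, ← mul_sum, sum_boole, filter_mem_eq_inter, univ_inter]
        simp
        ring

end CopywiseCoreset

/-! ### Facilities for all sets of clients -/

section AllSubsets

variable {k z t : ℕ} {ε : ℝ}

/-- One facility for every set of clients to which it is near, in `t + 1` copies. -/
abbrev allSubsets (t : ℕ) : Finset (Fin t) × Fin (t + 1) → Finset (Fin t) := Prod.fst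

lemma allSubsets_apply (A : Finset (Fin t)) (l : Fin (t + 1)) : allSubsets t (A, l) = A := rfl

/-- A coreset cannot tell a facility near all clients from one near only the coreset clients. -/
theorem card_ge_of_allSubsets (hz : 1 ≤ z) (hε : 0 < ε) (hε2 : ε < 1 / 2)
    (C : CopywiseCoreset k z (allSubsets t) ε) :
    (k : ℝ) * t * (1 - 2 * ε) ≤ ∑ i, (#(C.Ω i) : ℝ) := by
  classical
  have key : ∀ i, ∃ f g : Finset (Fin t) × Fin (t + 1),
      ∑ p, dist (Gadget.client p : Gadget z (allSubsets t)) (Gadget.facility f) ^ z = t ∧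
      3 * (t : ℝ) - 2 * #(C.Ω i) ≤
        ∑ p, dist (Gadget.client p : Gadget z (allSubsets t)) (Gadget.facility g) ^ z ∧
      ∑ x, C.u i x * dist x (Gadget.facility f) ^ z =
        ∑ x, C.u i x * dist x (Gadget.facility g) ^ z := by
    intro i
    by_cases hfree : ∃ l : Fin (t + 1), ∀ A, Gadget.facility (A, l) ∉ C.Ω i
    · obtain ⟨l, hl⟩ := hfree
      refine ⟨(univ, l), (C.clients i, l), ?_, ?_, ?_⟩
      · rw [CopywiseCoreset.sum_dist_client_pow hz]
        simp [allSubsets_apply]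
        ring
      · rw [CopywiseCoreset.sum_dist_client_pow hz]
        have : (#(C.clients i) : ℝ) ≤ #(C.Ω i) := by exact_mod_cast C.card_clients_le i
        simp
        linarith
      · rw [C.sum_weighted_facility hz i (C.eq_zero i _ (hl _)),
          C.sum_weighted_facility hz i (C.eq_zero i _ (hl _))]
        congr 1
        refine sum_congr rfl fun p _ => ?_
        by_cases hp : p ∈ C.clients i
        · simp [allSubsets_apply, hp]
        · simp [C.eq_zero_of_notMem_clients hp]
    · -- The copy has more than `t` coreset points, so the claimed lower bound is at most `t`.
      push Not at hfree
      choose A hA using hfree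
      have hcard : t + 1 ≤ #(C.Ω i) := by
        have := card_le_card_of_injOn (s := (univ : Finset (Fin (t + 1))))
          (fun l => (Gadget.facility (A l, l) : Gadget z (allSubsets t))) (fun l _ => hA l)
          (fun l _ l' _ h => congrArg Prod.snd (Sum.inr_injective (Option.some_injective _ h)))
        simpa using this
      have hcard' : (t : ℝ) + 1 ≤ #(C.Ω i) := by exact_mod_cast hcard
      refine ⟨(univ, 0), (univ, 0), ?_, ?_, rfl⟩ <;>
      · rw [CopywiseCoreset.sum_dist_client_pow hz]
        simp [allSubsets_apply]
        linarith
  choose f g hf hg hfg using key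
  have h1 := abs_le.1 (C.abs_sub_le fun i => Gadget.facility (f i))
  have h2 := abs_le.1 (C.abs_sub_le fun i => Gadget.facility (g i))
  simp only [hfg, hf] at h1
  have h3 := sum_le_sum fun i (_ : i ∈ univ) => hg i
  simp only [sum_sub_distrib, ← mul_sum] at h3
  simp only [sum_const, card_univ, Fintype.card_fin, nsmul_eq_mul] at h1 h3
  set X := ∑ i, ∑ p, dist (Gadget.client p : Gadget z (allSubsets t)) (Gadget.facility (g i)) ^ z
  set s := ∑ i, (#(C.Ω i) : ℝ)
  have hs : 0 ≤ s := sum_nonneg fun i _ => by positivity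
  have h4 : (1 - ε) * X ≤ (1 + ε) * (k * t) := by linarith [h1.1, h1.2, h2.1, h2.2]
  have h5 : (1 - ε) * (3 * (k * t) - 2 * s) ≤ (1 - ε) * X :=
    mul_le_mul_of_nonneg_left h3 (by linarith)
  nlinarith [mul_nonneg hε.le hs]

/-- For a coreset of clients, the far point forces the total weight to be large, while facilities
near just the coreset clients, or just the others, force it to be small. -/
theorem card_ge_of_allSubsets_of_clients (hz : 1 ≤ z) (hε : 0 < ε) (hε2 : ε < 1 / 2)
    (C : CopywiseCoreset k z (allSubsets t) ε) (hC : ∀ i, ∀ x ∈ C.Ω i, ∃ p, x = Gadget.client p) :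
    (k : ℝ) * t ≤ 8 * ∑ i, (#(C.Ω i) : ℝ) := by
  classical
  have hfac : ∀ i (g : Finset (Fin t) × Fin (t + 1)), C.u i (Gadget.facility g) = 0 := fun i g =>
    C.eq_zero i _ fun h => by
      obtain ⟨p, hp⟩ := hC i _ h
      exact Sum.inr_ne_inl (Option.some_injective _ hp)
  have hfar : ∀ i, C.u i Gadget.far = 0 := fun i =>
    C.eq_zero i _ fun h => by
      obtain ⟨p, hp⟩ := hC i _ h
      exact Option.some_ne_none _ hp.symm
  have hbase : ∀ i, C.base i = 0 := fun i => by simp [CopywiseCoreset.base, hfac, hfar]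
  set T : ℝ := k * t with hT
  set s : ℝ := ∑ i, (#(C.clients i) : ℝ) with hs
  set w : ℝ := ∑ i, ∑ p, C.u i (Gadget.client p) with hw
  have hw0 : 0 ≤ w := sum_nonneg fun i _ => sum_nonneg fun p _ => C.nonneg i _
  have hsΩ : s ≤ ∑ i, (#(C.Ω i) : ℝ) :=
    sum_le_sum fun i _ => by exact_mod_cast C.card_clients_le i
  have hT0 : 0 ≤ T := by positivity
  have hsT : s ≤ T := by
    calc s ≤ ∑ _i : Fin k, (t : ℝ) := sum_le_sum fun i _ => by
          have := card_le_univ (C.clients i)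
          rw [Fintype.card_fin] at this
          exact_mod_cast this
      _ = T := by simp [hT]
  -- A facility near `A i` in each copy.
  have hfacility : ∀ A : Fin k → Finset (Fin t), ∀ a : ℝ,
      (∀ i p, C.u i (Gadget.client p) * (if p ∈ A i then 1 else 3) =
        C.u i (Gadget.client p) * a) →
      |(3 * T - 2 * ∑ i, (#(A i) : ℝ)) - (C.K + w * a)| ≤
        ε * (3 * T - 2 * ∑ i, (#(A i) : ℝ)) := by
    intro A a hA
    have h := C.abs_sub_le fun i => Gadget.facility (A i, 0)
    simp only [CopywiseCoreset.sum_dist_client_pow hz, C.sum_weighted_facility hz _ (hfac _ _),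
      hbase, zero_add, hA, sum_sub_distrib, ← mul_sum, ← sum_mul] at h
    simpa [hT, hw, mul_left_comm] using h
  have hcompl : ∑ i, (#(C.clients i)ᶜ : ℝ) = T - s := by
    have : ∀ i, (#(C.clients i)ᶜ : ℝ) = t - #(C.clients i) := fun i => by
      rw [card_compl, Fintype.card_fin, Nat.cast_sub]
      simpa using card_le_univ (C.clients i)
    simp [this, hT, hs]
  have h1 := hfacility (fun _ => univ) 1 (by simp)
  have h2 := hfacility C.clients 1 fun i p => by
    by_cases hp : p ∈ C.clients i
    · simp [hp]
    · simp [C.eq_zero_of_notMem_clients hp]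
  have h3 := hfacility (fun i => (C.clients i)ᶜ) 3 fun i p => by
    by_cases hp : p ∈ C.clients i
    · simp [hp]
    · simp [C.eq_zero_of_notMem_clients hp]
  have h4 : |6 ^ z * T - (C.K + w * 6 ^ z)| ≤ ε * (6 ^ z * T) := by
    have h := C.abs_sub_le fun _ => Gadget.far
    simp only [Gadget.sum_univ, Gadget.dist_client_far, hfac, hfar, zero_mul, zero_add,
      sum_const_zero, add_zero, ← sum_mul] at h
    simpa [hT, hw, mul_comm, mul_left_comm, mul_assoc] using h
  rw [hcompl] at h3
  simp only [card_univ, Fintype.card_fin, sum_const, nsmul_eq_mul, ← hT, ← hs] at h1 h2 h3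
  have h6 : (6 : ℝ) ≤ 6 ^ z := by
    calc (6 : ℝ) = 6 ^ 1 := by norm_num
      _ ≤ 6 ^ z := pow_le_pow_right₀ (by norm_num) hz
  rw [abs_le] at h1 h2 h3 h4
  have e1 : C.K + w ≤ 3 / 2 * T := by nlinarith [h1.1]
  have e2 : 3 / 2 * T - s ≤ C.K + w := by nlinarith [h2.2]
  have hs0 : 0 ≤ s := sum_nonneg fun i _ => by positivity
  have e3 : C.K + w * 3 ≤ 3 / 2 * (T + 2 * s) := by nlinarith [h3.1]
  have e4 : 6 ^ z * (T / 2 - w) ≤ C.K := by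
    have : ε * (6 ^ z * T) ≤ 1 / 2 * (6 ^ z * T) := by gcongr
    linarith [h4.2]
  have e5 : T / 4 ≤ w := by
    by_contra hlt
    have : 6 * (T / 2 - w) ≤ 6 ^ z * (T / 2 - w) :=
      mul_le_mul_of_nonneg_right h6 (by linarith)
    linarith
  linarith

end AllSubsets

/-! ### Facilities given by block signs -/

section SignBlocks

variable {k z d m J : ℕ} {ε : ℝ}

/-- The clients form `d` blocks of size `m`. A facility has a common row `j` of the set system `H`
and one sign for every block, and is near the clients of a block that belong to `H j` or near the
others, according to the sign; there are `d + 1` copies of each facility. -/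
def signBlocks (d : ℕ) (H : Fin J → Finset (Fin m)) :
    Fin J × Fin (d + 1) × (Fin d → Bool) → Finset (Fin d × Fin m) :=
  fun f => {q | decide (q.2 ∈ H f.1) = f.2.2 q.1}

/-- The sign `1` for `true` and `-1` for `false`. -/
def boolSign (b : Bool) : ℝ := if b then 1 else -1

lemma ite_mem_signBlocks (H : Fin J → Finset (Fin m)) (f : Fin J × Fin (d + 1) × (Fin d → Bool))
    (q : Fin d × Fin m) :
    (if q ∈ signBlocks d H f then (1 : ℝ) else 3) =
      2 - boolSign (f.2.2 q.1) * sgn (H f.1) q.2 := by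
  by_cases h : q.2 ∈ H f.1 <;> cases hb : f.2.2 q.1 <;>
    simp [signBlocks, boolSign, sgn, h, hb] <;> norm_num

namespace CopywiseCoreset

variable {H : Fin J → Finset (Fin m)}

/-- The residual weights `1 - u` of the clients, multiplied by the signs of row `j` and summed over
block `b` of copy `i`. -/
noncomputable def blockProduct (C : CopywiseCoreset k z (signBlocks d H) ε) (i : Fin k) (j : Fin J)
    (b : Fin d) : ℝ :=
  ∑ p, (1 - C.u i (Gadget.client (b, p))) * sgn (H j) p

lemma cost_sub_weighted_eq (C : CopywiseCoreset k z (signBlocks d H) ε) (hz : 1 ≤ z) (i : Fin k)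
    {f : Fin J × Fin (d + 1) × (Fin d → Bool)} (hf : C.u i (Gadget.facility f) = 0) :
    ∑ q, dist (Gadget.client q : Gadget z (signBlocks d H)) (Gadget.facility f) ^ z -
      ∑ x, C.u i x * dist x (Gadget.facility f) ^ z =
    (∑ q, (1 - C.u i (Gadget.client q)) * 2 - C.base i) -
      ∑ b, boolSign (f.2.2 b) * C.blockProduct i f.1 b := by
  rw [C.sum_weighted_facility hz i hf]
  have h : ∑ b, boolSign (f.2.2 b) * C.blockProduct i f.1 b =
      ∑ q : Fin d × Fin m, (1 - C.u i (Gadget.client q)) *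
        (boolSign (f.2.2 q.1) * sgn (H f.1) q.2) := by
    rw [Fintype.sum_prod_type]
    refine sum_congr rfl fun b _ => ?_
    rw [blockProduct, mul_sum]
    exact sum_congr rfl fun p _ => by ring
  simp only [Gadget.dist_client_facility_pow hz, ite_mem_signBlocks]
  rw [h, sub_add_eq_sub_sub_swap, ← sum_sub_distrib, sub_right_comm, ← sum_sub_distrib]
  congr 1
  exact sum_congr rfl fun q _ => by ring

/-- If few coreset points lie in copy `i`, then opposite choices of the block signs give
facilities for which cost and coreset cost differ by very different amounts. -/
lemma exists_facilities_sub_ge (C : CopywiseCoreset k z (signBlocks d H) ε) (hz : 1 ≤ z)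
    (hm : 1 ≤ m) (hJ : J = 128 * m)
    (hH : ∀ v : Fin m → ℝ, 16 * #{p | v p ≠ 1} ≤ m →
      2 * m ≤ #{j | √m / 4 ≤ |∑ p, v p * sgn (H j) p|}) (i : Fin k) :
    ∃ f g, (d - 17 * #(C.Ω i) / m) * (√m / 256) ≤
      (∑ q, dist (Gadget.client q : Gadget z (signBlocks d H)) (Gadget.facility f) ^ z -
        ∑ x, C.u i x * dist x (Gadget.facility f) ^ z) -
      (∑ q, dist (Gadget.client q : Gadget z (signBlocks d H)) (Gadget.facility g) ^ z -
        ∑ x, C.u i x * dist x (Gadget.facility g) ^ z) := by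
  classical
  have hm0 : (0 : ℝ) < m := by exact_mod_cast hm
  have hsq : 0 < √(m : ℝ) := Real.sqrt_pos.2 hm0
  -- Rows for which every copy of the facilities meets the coreset.
  set killed : Finset (Fin J) := {j | ∀ l, ∃ τ, Gadget.facility (j, l, τ) ∈ C.Ω i} with hkilled
  have hkill : #killed * (d + 1) ≤ #(C.Ω i) := by
    have hτ : ∀ q : Fin J × Fin (d + 1), ∃ τ, q.1 ∈ killed →
        Gadget.facility (q.1, q.2, τ) ∈ C.Ω i := by
      intro q
      by_cases hq : q.1 ∈ killed
      · obtain ⟨τ, h⟩ := (mem_filter.1 hq).2 q.2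
        exact ⟨τ, fun _ => h⟩
      · exact ⟨fun _ => true, fun h => absurd h hq⟩
    choose τ hτ using hτ
    have := card_le_card_of_injOn (s := killed ×ˢ (univ : Finset (Fin (d + 1))))
      (fun q => (Gadget.facility (q.1, q.2, τ q) : Gadget z (signBlocks d H)))
      (fun q hq => hτ q (mem_product.1 hq).1) (fun q _ q' _ h => by
        have h' : (q.1, q.2, τ q) = (q'.1, q'.2, τ q') :=
          Sum.inr_injective (Option.some_injective _ h)
        exact Prod.ext (congrArg (fun x => x.1) h') (congrArg (fun x => x.2.1) h'))
    simpa [card_product] using this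
  by_cases hbad : m < #killed
  · -- The copy has so many coreset points that the left-hand side is nonpositive.
    let f : Fin J × Fin (d + 1) × (Fin d → Bool) := (⟨0, by omega⟩, 0, fun _ => true)
    refine ⟨f, f, ?_⟩
    have h1 : m * d ≤ #(C.Ω i) := le_trans (Nat.mul_le_mul hbad.le (Nat.le_succ d)) hkill
    have h2 : (d : ℝ) ≤ #(C.Ω i) / m := by
      rw [le_div_iff₀ hm0, mul_comm]
      exact_mod_cast h1
    have h3 : (0 : ℝ) ≤ #(C.Ω i) / m := by positivity
    have h4 : (17 : ℝ) * #(C.Ω i) / m = 17 * (#(C.Ω i) / m) := by ring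
    rw [sub_self]
    exact mul_nonpos_of_nonpos_of_nonneg (by linarith) (by positivity)
  push Not at hbad
  -- Blocks with few coreset clients.
  set good : Finset (Fin d) := {b | 16 * #{p | (b, p) ∈ C.clients i} ≤ m} with hgood
  have hgoodcard : (d : ℝ) - 16 * #(C.Ω i) / m ≤ #good := by
    have h1 : ∑ b, #({p | (b, p) ∈ C.clients i} : Finset (Fin m)) ≤ #(C.Ω i) := by
      refine le_trans (le_of_eq ?_) (C.card_clients_le i)
      rw [← card_sigma]
      refine card_bij (fun q _ => (q.1, q.2)) (fun q hq => by simpa using hq)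
        (fun q _ q' _ h => ?_) (fun q hq => ⟨⟨q.1, q.2⟩, by simpa using hq, rfl⟩)
      obtain ⟨a, b⟩ := q
      obtain ⟨a', b'⟩ := q'
      simp only [Prod.mk.injEq] at h
      obtain ⟨rfl, rfl⟩ := h
      rfl
    have h2 : #goodᶜ * m ≤ 16 * #(C.Ω i) := by
      calc #goodᶜ * m = ∑ _b ∈ goodᶜ, m := by simp
        _ ≤ ∑ b ∈ goodᶜ, 16 * #({p | (b, p) ∈ C.clients i} : Finset (Fin m)) := by
            refine sum_le_sum fun b hb => ?_
            simp only [hgood, mem_compl, mem_filter, mem_univ, true_and, not_le] at hb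
            exact hb.le
        _ ≤ ∑ b, 16 * #({p | (b, p) ∈ C.clients i} : Finset (Fin m)) :=
            sum_le_sum_of_subset (subset_univ _)
        _ ≤ _ := by rw [← mul_sum]; omega
    have h3 : #good + #goodᶜ = d := by rw [card_add_card_compl, Fintype.card_fin]
    have h4 : (#goodᶜ : ℝ) ≤ 16 * #(C.Ω i) / m := by
      rw [le_div_iff₀ hm0]
      exact_mod_cast h2
    have h5 : (#good : ℝ) + #goodᶜ = d := by exact_mod_cast h3
    linarith
  -- Averaging over the rows that are not killed yields one that is large on many good blocks.
  obtain ⟨j, hj, hjsum⟩ : ∃ j ∉ killed, #good * (√m / 512) ≤ ∑ b, |C.blockProduct i j b| := by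
    by_contra hcon
    push Not at hcon
    have hblock : ∀ b ∈ good, (m : ℝ) * (√m / 4) ≤ ∑ j ∈ killedᶜ, |C.blockProduct i j b| := by
      intro b hb
      have hv := hH (fun p => 1 - C.u i (Gadget.client (b, p))) (by
        refine le_trans (Nat.mul_le_mul le_rfl (card_le_card fun p hp => ?_))
          (mem_filter.1 hb).2
        simp only [mem_filter, mem_univ, true_and] at hp ⊢
        by_contra h
        exact hp (by rw [C.eq_zero_of_notMem_clients h, sub_zero]))
      set L : Finset (Fin J) := {j | √m / 4 ≤ |C.blockProduct i j b|} with hL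
      have hv' : 2 * m ≤ #L := hv
      have hcard : m ≤ #(L \ killed) := by
        have := le_card_sdiff killed L
        omega
      calc (m : ℝ) * (√m / 4) ≤ #(L \ killed) * (√m / 4) := by gcongr
        _ = ∑ j ∈ L \ killed, √m / 4 := by simp
        _ ≤ ∑ j ∈ L \ killed, |C.blockProduct i j b| :=
            sum_le_sum fun j hj => (mem_filter.1 (mem_sdiff.1 hj).1).2
        _ ≤ _ := sum_le_sum_of_subset_of_nonneg
            (fun j hj => mem_compl.2 (mem_sdiff.1 hj).2) fun j _ _ => abs_nonneg _
    have h1 : #good * ((m : ℝ) * (√m / 4)) ≤ ∑ j ∈ killedᶜ, ∑ b, |C.blockProduct i j b| := by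
      rw [sum_comm]
      calc #good * ((m : ℝ) * (√m / 4)) = ∑ b ∈ good, (m : ℝ) * (√m / 4) := by simp
        _ ≤ ∑ b ∈ good, ∑ j ∈ killedᶜ, |C.blockProduct i j b| := sum_le_sum hblock
        _ ≤ _ := sum_le_sum_of_subset_of_nonneg (subset_univ _)
            fun b _ _ => sum_nonneg fun j _ => abs_nonneg _
    have hne : killedᶜ.Nonempty := by
      rw [← card_pos, card_compl, Fintype.card_fin]
      omega
    have h2 : ∑ j ∈ killedᶜ, ∑ b, |C.blockProduct i j b| <
        ∑ j ∈ killedᶜ, #good * (√m / 512) :=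
      sum_lt_sum_of_nonempty hne fun j hj => hcon j (mem_compl.1 hj)
    have h3 : ∑ j ∈ killedᶜ, #good * (√(m : ℝ) / 512) ≤ (128 * m) * (#good * (√m / 512)) := by
      rw [sum_const, nsmul_eq_mul]
      have : (#killedᶜ : ℝ) ≤ 128 * m := by
        have := card_le_univ killedᶜ
        rw [Fintype.card_fin] at this
        exact_mod_cast this.trans hJ.le
      gcongr
    have h4 : (128 * m) * (#good * (√(m : ℝ) / 512)) = #good * ((m : ℝ) * (√m / 4)) := by ring
    linarith
  obtain ⟨l, hl⟩ : ∃ l, ∀ τ, Gadget.facility (j, l, τ) ∉ C.Ω i := by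
    simpa [hkilled] using hj
  refine ⟨(j, l, fun b => decide (C.blockProduct i j b < 0)),
    (j, l, fun b => !decide (C.blockProduct i j b < 0)), ?_⟩
  rw [C.cost_sub_weighted_eq hz i (C.eq_zero i _ (hl _)),
    C.cost_sub_weighted_eq hz i (C.eq_zero i _ (hl _))]
  have hp : ∑ b, boolSign (decide (C.blockProduct i j b < 0)) * C.blockProduct i j b =
      -∑ b, |C.blockProduct i j b| := by
    rw [← sum_neg_distrib]
    refine sum_congr rfl fun b _ => ?_
    by_cases h : C.blockProduct i j b < 0
    · simp [boolSign, h, abs_of_neg h]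
    · simp [boolSign, h, abs_of_nonneg (not_lt.1 h)]
  have hn : ∑ b, boolSign (!decide (C.blockProduct i j b < 0)) * C.blockProduct i j b =
      ∑ b, |C.blockProduct i j b| := by
    refine sum_congr rfl fun b _ => ?_
    by_cases h : C.blockProduct i j b < 0
    · simp [boolSign, h, abs_of_neg h]
    · simp [boolSign, h, abs_of_nonneg (not_lt.1 h)]
  simp only [hp, hn]
  have h6 : ((d : ℝ) - 17 * #(C.Ω i) / m) ≤ #good := by
    have : (0 : ℝ) ≤ #(C.Ω i) / m := by positivity
    have e1 : (17 : ℝ) * #(C.Ω i) / m = 17 * (#(C.Ω i) / m) := by ring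
    have e2 : (16 : ℝ) * #(C.Ω i) / m = 16 * (#(C.Ω i) / m) := by ring
    linarith
  have h7 : ((d : ℝ) - 17 * #(C.Ω i) / m) * (√m / 256) ≤ #good * (√m / 256) := by gcongr
  linarith

theorem card_ge_of_signBlocks (C : CopywiseCoreset k z (signBlocks d H) ε) (hz : 1 ≤ z)
    (hm : 1 ≤ m) (hJ : J = 128 * m)
    (hH : ∀ v : Fin m → ℝ, 16 * #{p | v p ≠ 1} ≤ m →
      2 * m ≤ #{j | √m / 4 ≤ |∑ p, v p * sgn (H j) p|})
    (hε : 0 < ε) (hεm : 3072 * ε * √m ≤ 1) :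
    (k : ℝ) * d * m ≤ 34 * ∑ i, (#(C.Ω i) : ℝ) := by
  have hm0 : (0 : ℝ) < m := by exact_mod_cast hm
  have hsq : 0 < √(m : ℝ) := Real.sqrt_pos.2 hm0
  choose f g hfg using C.exists_facilities_sub_ge hz hm hJ hH
  have hcost : ∀ f : Fin k → Fin J × Fin (d + 1) × (Fin d → Bool),
      ∑ i, ∑ q, dist (Gadget.client q : Gadget z (signBlocks d H)) (Gadget.facility (f i)) ^ z ≤
        3 * (k * d * m) := by
    intro f
    simp only [sum_dist_client_pow hz]
    calc _ ≤ ∑ _i : Fin k, (3 * (d * m) : ℝ) := by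
          refine sum_le_sum fun i _ => ?_
          simp
      _ = _ := by simp; ring
  have h1 := abs_le.1 (C.abs_sub_le fun i => Gadget.facility (f i))
  have h2 := abs_le.1 (C.abs_sub_le fun i => Gadget.facility (g i))
  have h3 := sum_le_sum fun i (_ : i ∈ univ) => hfg i
  simp only [sum_sub_distrib, ← sum_mul, ← sum_div, ← mul_sum] at h3
  simp only [sum_const, card_univ, Fintype.card_fin, nsmul_eq_mul] at h3
  set s := ∑ i, (#(C.Ω i) : ℝ)
  have h4 : (k * d - 17 * s / m) * (√m / 256) ≤ 6 * ε * (k * d * m) := by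
    have e1 := mul_le_mul_of_nonneg_left (hcost f) hε.le
    have e2 := mul_le_mul_of_nonneg_left (hcost g) hε.le
    linarith [h1.2, h2.1]
  have h5 : (k * d * m - 17 * s) * √m ≤ (k * d * m) / 2 * √m := by
    have e : √(m : ℝ) * √m = m := Real.mul_self_sqrt hm0.le
    have e1 : (k * d * m - 17 * s) * √m = (k * d - 17 * s / m) * (√m / 256) * (256 * m) := by
      field_simp
    have e2 : (k * d * m : ℝ) * (3072 * ε * √m) ≤ k * d * m * 1 := by gcongr
    calc _ = (k * d - 17 * s / m) * (√m / 256) * (256 * m) := e1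
      _ ≤ 6 * ε * (k * d * m) * (256 * m) := by gcongr
      _ = (k * d * m : ℝ) * (3072 * ε * √m) / 2 * √m := by
          linear_combination (-1536 * ε * (k * d * m)) * e
      _ ≤ _ := mul_le_mul_of_nonneg_right (by linarith) hsq.le
  have h6 := le_of_mul_le_mul_right h5 hsq
  linarith

end CopywiseCoreset

end SignBlocks

/-! ### Choice of the parameters -/

section Assembly

/-- A lower bound for copywise coresets gives one for coresets in a tower of gadgets. The number of
spare copies is chosen so that the doubling constant is `⌊2 ^ D⌋`. -/
theorem exists_graphMetric_of_gadget {I F : Type} [Fintype I] [Fintype F] (near : F → Finset I)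
    {k z : ℕ} (hk : 1 ≤ k) {ε ε₀ D B : ℝ} (h2 : (2 : ℝ) ≤ 2 ^ D)
    (hcard : (Fintype.card I + Fintype.card F + 1 : ℝ) ≤ 2 ^ D)
    (hB : ∀ C : CopywiseCoreset k z near ε,
      ((∀ i, ∀ x ∈ C.Ω i, ∃ p, x = Gadget.client p) ∨ ε ≤ ε₀) → B ≤ ∑ i, (#(C.Ω i) : ℝ)) :
    ∃ (V : Type) (_ : Finite V) (_ : MetricSpace V) (P : Finset V),
      IsGraphMetric V ∧ DoublingDimLE V D ∧
      ((∃ N : ℕ, (2 : ℝ) ^ D = (N : ℝ)) → IsDoublingDim V D) ∧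
      ∀ (Ω : Finset V) (w : V → ℝ) (Δ : ℝ), (Ω ⊆ P ∨ ε ≤ ε₀) →
        IsCoreset ε k z P Ω w Δ → B ≤ (Ω.card : ℝ) := by
  obtain ⟨n, hn⟩ : ∃ n, ⌊(2 : ℝ) ^ D⌋₊ = n + 1 :=
    Nat.exists_eq_succ_of_ne_zero (Nat.floor_pos.2 (by linarith)).ne'
  have hn1 : 1 ≤ n := by
    have : 2 ≤ ⌊(2 : ℝ) ^ D⌋₊ := Nat.le_floor (by exact_mod_cast h2)
    omega
  have hW : Fintype.card (Gadget z near) ≤ n + 1 := by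
    rw [Gadget.card, ← hn]
    exact Nat.le_floor (by exact_mod_cast hcard)
  have hnD : (n : ℝ) + 1 ≤ 2 ^ D := by
    have := Nat.floor_le (a := (2 : ℝ) ^ D) (by positivity)
    rw [hn] at this
    exact_mod_cast this
  refine ⟨Tower k n (Gadget z near), inferInstance, inferInstance, allClients k n z near,
    isGraphMetric_of_metricSpace _, Tower.doublingDimLE Gadget.far hk hn1 hW hnD, ?_, ?_⟩
  · rintro ⟨N, hN⟩
    refine Tower.isDoublingDim Gadget.far hk hn1 hW ?_
    rw [hN, Nat.floor_natCast] at hn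
    rw [hN, hn]
    push_cast
    rfl
  · intro Ω w Δ hΩ hcore
    obtain ⟨C, hC, hclients⟩ := exists_copywiseCoreset hk hcore
    refine (hB C (hΩ.imp_left hclients)).trans ?_
    exact_mod_cast hC

lemma two_pow_add_one_mul_le (s : ℕ) : (2 ^ (s + 2) + 1) * (s + 3) ≤ 16 ^ (s + 1) := by
  induction s with
  | zero => norm_num
  | succ s ih =>
    calc (2 ^ (s + 1 + 2) + 1) * (s + 1 + 3) ≤ (2 * (2 ^ (s + 2) + 1)) * (8 * (s + 3)) :=
          Nat.mul_le_mul (by rw [show s + 1 + 2 = s + 2 + 1 from rfl, pow_succ]; omega) (by omega)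
      _ = 16 * ((2 ^ (s + 2) + 1) * (s + 3)) := by ring
      _ ≤ 16 * 16 ^ (s + 1) := Nat.mul_le_mul le_rfl ih
      _ = 16 ^ (s + 1 + 1) := by ring

lemma card_allSubsets_le {D : ℝ} (hD : 3 ≤ D) :
    ((⌊D / 4⌋₊ + 1 : ℕ) : ℝ) + 2 ^ (⌊D / 4⌋₊ + 1) * ((⌊D / 4⌋₊ + 1 : ℕ) + 1) + 1 ≤ (2 : ℝ) ^ D := by
  rcases h : ⌊D / 4⌋₊ with - | s
  · have : (2 : ℝ) ^ (3 : ℝ) ≤ 2 ^ D := Real.rpow_le_rpow_of_exponent_le (by norm_num) hD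
    norm_num at this ⊢
    linarith
  · have h1 : ((s + 1 : ℕ) : ℝ) ≤ D / 4 := by
      rw [← h]
      exact Nat.floor_le (by linarith)
    calc _ = (((2 ^ (s + 2) + 1) * (s + 3) : ℕ) : ℝ) := by push_cast; ring
      _ ≤ ((16 ^ (s + 1) : ℕ) : ℝ) := by exact_mod_cast two_pow_add_one_mul_le s
      _ = (2 : ℝ) ^ (4 * ((s + 1 : ℕ) : ℝ)) := by
          rw [Real.rpow_mul (by norm_num), Real.rpow_natCast]
          norm_num
      _ ≤ _ := Real.rpow_le_rpow_of_exponent_le (by norm_num) (by linarith)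

lemma one_div_sq_le_two_rpow {ε D : ℝ} (hε : 0 < ε) (hD : 5 * Real.log (1 / ε) ≤ D)
    (hD0 : 0 ≤ D) : (1 / ε) ^ 2 ≤ (2 : ℝ) ^ (3 / 5 * D) := by
  have h1 : (1 / ε) ^ 2 = Real.exp (2 * Real.log (1 / ε)) := by
    rw [two_mul, Real.exp_add, Real.exp_log (by positivity)]
    ring
  rw [h1, Real.rpow_def_of_pos (by norm_num)]
  refine Real.exp_le_exp.2 ?_
  nlinarith [Real.log_two_gt_d9]

lemma card_signBlocks_le {ε D : ℝ} {m : ℕ} (hε : 0 < ε) (hD : 5 * Real.log (1 / ε) ≤ D)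
    (hD0 : 0 ≤ D) (hm : 1 ≤ m) (hmε : (m : ℝ) ≤ (1 / (3072 * ε)) ^ 2) {d : ℕ}
    (hd : (d : ℝ) ≤ D / 20 + 1) :
    (d * m : ℝ) + 128 * m * ((d + 1) * 2 ^ d) + 1 ≤ (2 : ℝ) ^ D := by
  have hm1 : (1 : ℝ) ≤ m := by exact_mod_cast hm
  have h2d : (1 : ℝ) ≤ 2 ^ d := one_le_pow₀ (by norm_num)
  have hd1 : (d : ℝ) + 1 ≤ 2 ^ d := by exact_mod_cast Nat.lt_two_pow_self (n := d)
  have h4 : ((2 : ℝ) ^ d) * 2 ^ d ≤ 4 * 2 ^ (D / 10) := by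
    calc ((2 : ℝ) ^ d) * 2 ^ d = 2 ^ (2 * (d : ℝ)) := by
          rw [← pow_add, ← Real.rpow_natCast]
          congr 1
          push_cast
          ring
      _ ≤ 2 ^ (2 + D / 10) := Real.rpow_le_rpow_of_exponent_le (by norm_num) (by linarith)
      _ = _ := by
          rw [Real.rpow_add (by norm_num)]
          norm_num
  have hsmall : (516 : ℝ) * m ≤ (1 / ε) ^ 2 := by
    have : (1 / (3072 * ε)) ^ 2 = (1 / ε) ^ 2 / 9437184 := by
      field_simp
      norm_num
    have h0 : 0 ≤ (1 / ε) ^ 2 := by positivity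
    linarith
  calc (d * m : ℝ) + 128 * m * ((d + 1) * 2 ^ d) + 1
      ≤ 129 * m * ((d + 1) * 2 ^ d) := by
        have : m * (d + 1) * 1 ≤ m * (d + 1) * (2 : ℝ) ^ d := by gcongr
        linarith
    _ ≤ 129 * m * (2 ^ d * 2 ^ d) := by gcongr
    _ ≤ 129 * m * (4 * 2 ^ (D / 10)) := by gcongr
    _ = 516 * m * 2 ^ (D / 10) := by ring
    _ ≤ 2 ^ (3 / 5 * D) * 2 ^ (D / 10) := by
        gcongr
        exact hsmall.trans (one_div_sq_le_two_rpow hε hD hD0)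
    _ = 2 ^ (3 / 5 * D + D / 10) := by rw [Real.rpow_add (by norm_num)]
    _ ≤ _ := Real.rpow_le_rpow_of_exponent_le (by norm_num) (by linarith)

end Assembly

theorem mainTheorem4 (A : ℝ) (ε₀ : ℝ) (hε₀ : ε₀ < 1 / 2) :
    ∃ c : ℝ, 0 < c ∧
      ∀ (z k : ℕ) (ε D : ℝ), 1 ≤ z → 1 ≤ k → 0 < ε → ε < 1 / 2 →
        5 * Real.log (1 / ε) ≤ D → Real.log (k : ℝ) ≤ A * D →
        ∃ (V : Type) (_ : Finite V) (_ : MetricSpace V) (P : Finset V),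
          IsGraphMetric V ∧
          DoublingDimLE V D ∧
          ((∃ N : ℕ, (2 : ℝ) ^ D = (N : ℝ)) → IsDoublingDim V D) ∧
          ∀ (Ω : Finset V) (w : V → ℝ) (Δ : ℝ),
            (Ω ⊆ P ∨ ε ≤ ε₀) →
            IsCoreset ε k z P Ω w Δ →
            c * ((k : ℝ) * D / ε ^ 2) ≤ (Ω.card : ℝ) := by
  set κ : ℝ := min (1 / 8) (1 - 2 * ε₀) with hκ
  have hκ0 : 0 < κ := lt_min (by norm_num) (by linarith)
  refine ⟨min (1 / (1360 * 3072 ^ 2)) (κ / (4 * 3072 ^ 2)), by positivity, ?_⟩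
  intro z k ε D hz hk hε hε2 hD _
  have hD3 : 3 ≤ D := by
    have h1 : Real.log 2 ≤ Real.log (1 / ε) :=
      Real.log_le_log (by norm_num) (by rw [le_div_iff₀ hε]; linarith)
    linarith [Real.log_two_gt_d9]
  have h2D : (2 : ℝ) ≤ 2 ^ D := by
    calc (2 : ℝ) = 2 ^ (1 : ℝ) := by norm_num
      _ ≤ _ := Real.rpow_le_rpow_of_exponent_le (by norm_num) (by linarith)
  have hk0 : (0 : ℝ) ≤ k := Nat.cast_nonneg k
  have hX : 0 ≤ (k : ℝ) * D / ε ^ 2 := by positivity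
  by_cases hsmall : ε ≤ 1 / 3072
  · have hx1 : 1 ≤ (1 / (3072 * ε)) ^ 2 := by
      refine one_le_pow₀ ?_
      rw [le_div_iff₀ (by positivity)]
      linarith
    set m := ⌊(1 / (3072 * ε)) ^ 2⌋₊ with hm
    have hm1 : 1 ≤ m := Nat.le_floor (by exact_mod_cast hx1)
    have hmle : (m : ℝ) ≤ (1 / (3072 * ε)) ^ 2 := Nat.floor_le (by positivity)
    have hmge : (1 / (3072 * ε)) ^ 2 ≤ 2 * m := by
      have h1 := Nat.lt_floor_add_one ((1 / (3072 * ε)) ^ 2)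
      have h2 : (1 : ℝ) ≤ m := by exact_mod_cast hm1
      linarith
    set d := ⌊D / 20⌋₊ + 1 with hd
    have hdle : (d : ℝ) ≤ D / 20 + 1 := by
      have := Nat.floor_le (a := D / 20) (by linarith)
      push_cast [hd]
      linarith
    have hdge : D / 20 ≤ d := by
      have := Nat.lt_floor_add_one (D / 20)
      push_cast [hd]
      linarith
    obtain ⟨H, hH⟩ := exists_signs_large_products m hm1
    refine exists_graphMetric_of_gadget (signBlocks d H) hk h2D ?_ ?_
    · have := card_signBlocks_le hε hD (by linarith) hm1 hmle hdle
      simpa using this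
    · intro C _
      have hεm : 3072 * ε * √m ≤ 1 := by
        have : √(m : ℝ) ≤ 1 / (3072 * ε) := Real.sqrt_le_iff.2 ⟨by positivity, hmle⟩
        rwa [le_div_iff₀ (by positivity), mul_comm] at this
      have h := C.card_ge_of_signBlocks hz hm1 rfl hH hε hεm
      have h1 : (k : ℝ) * (D / 20) * ((1 / (3072 * ε)) ^ 2 / 2) ≤ k * d * m := by
        gcongr
        linarith
      have h2 : (k : ℝ) * (D / 20) * ((1 / (3072 * ε)) ^ 2 / 2) =
          34 * (1 / (1360 * 3072 ^ 2) * (k * D / ε ^ 2)) := by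
        field_simp
        norm_num
      have h3 := mul_le_mul_of_nonneg_right (min_le_left (1 / (1360 * 3072 ^ 2))
        (κ / (4 * 3072 ^ 2))) hX
      linarith
  · push Not at hsmall
    set t := ⌊D / 4⌋₊ + 1 with ht
    have htge : D / 4 ≤ t := by
      have := Nat.lt_floor_add_one (D / 4)
      push_cast [ht]
      linarith
    refine exists_graphMetric_of_gadget (allSubsets t) hk h2D ?_ ?_
    · have := card_allSubsets_le hD3
      rw [← ht] at this
      simpa using this
    · intro C hC
      have h : κ * (k * t) ≤ ∑ i, (#(C.Ω i) : ℝ) := by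
        have hkt : (0 : ℝ) ≤ k * t := by positivity
        rcases hC with hC | hC
        · have h1 := card_ge_of_allSubsets_of_clients hz hε hε2 C hC
          have h2 := mul_le_mul_of_nonneg_right (min_le_left (1 / 8) (1 - 2 * ε₀)) hkt
          linarith
        · have h1 := card_ge_of_allSubsets hz hε hε2 C
          have h2 := mul_le_mul_of_nonneg_right (min_le_right (1 / 8) (1 - 2 * ε₀)) hkt
          have h3 : (1 - 2 * ε₀) * (k * t) ≤ (1 - 2 * ε) * (k * t) := by gcongr
          linarith
      have h1 : (k : ℝ) * D / ε ^ 2 ≤ k * (4 * t) * 3072 ^ 2 := by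
        rw [div_le_iff₀ (by positivity)]
        have h2 : 1 ≤ 3072 ^ 2 * ε ^ 2 := by
          rw [← mul_pow]
          refine one_le_pow₀ ?_
          linarith
        calc (k : ℝ) * D ≤ k * (4 * t) * 1 := by rw [mul_one]; gcongr; linarith
          _ ≤ k * (4 * t) * (3072 ^ 2 * ε ^ 2) := by gcongr
          _ = _ := by ring
      calc _ ≤ κ / (4 * 3072 ^ 2) * (k * D / ε ^ 2) :=
            mul_le_mul_of_nonneg_right (min_le_right _ _) hX
        _ ≤ κ / (4 * 3072 ^ 2) * (k * (4 * t) * 3072 ^ 2) := by gcongr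
        _ = κ * (k * t) := by ring
        _ ≤ _ := h
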